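/- For $k=2^l-1$ let $\mathit{CBT}_k$ be the complete binary tree with $l$ levels and $k$ vertices. Let $k_1\ge k_2\ge\cdots\ge k_d$ be integers of the form $k_i=2^{l_i}-1$ with $l_i\ge 2$ (so that every factor has at least one edge), and let $\mathit{MCT}^{(d)}_{k_1,\ldots,k_d}=\mathit{CBT}_{k_1}\times\cdots\times\mathit{CBT}_{k_d}$ be the $d$-dimensional mesh-connected trees, where $\times$ denotes the Cartesian product of graphs (two vertices are adjacent when they differ in exactly one coordinate $i$ and their $i$-th coordinates are adjacent in $\mathit{CBT}_{k_i}$). For a graph $G$ with $n$ vertices, let the bisection width $BW(G)$ be the minimum, over all sets $S$ of $\lfloor n/2\rfloor$ vertices, of the number of edges of $G$ with exactly one endpoint in $S$. Then $$BW\bigl(\mathit{MCT}^{(d)}_{k_1,\ldots,k_d}\bigr)=\Psi(d),\qquad\text{where}\qquad \Psi(d)=\sum_{i=1}^{d}\ \prod_{j=i+1}^{d}k_j .$$ -/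

import Mathlib

/-! Replace each tree on `k` vertices by the complete graph with edge weight `4 / (k ^ 2 - 1)`.
Join every pair of vertices by its path in the tree: an edge separating `s` vertices from the
other `k - s` is used by `s * (k - s) ≤ (k ^ 2 - 1) / 4` pairs, so the weighted cut of a set in
the complete graph never exceeds its cut in the tree. It therefore suffices to solve the
edge-isoperimetric problem in the product of the weighted complete graphs, where the
lexicographic initial segments turn out to be optimal. For three or more factors this follows
from their optimality in the product of all factors but the first and in that of all factors but
the last: compressing the slices in these two directions leaves a set consisting of full slices
followed by at most two partial ones, and comparing it with an initial segment is a computation.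
For two factors of orders `h ≤ k`, the cut is bounded below in terms of the residues modulo `h`
of the `h` column sizes, and these satisfy an isoperimetric inequality on `ZMod h`.

The initial segment of half the size has weighted cut exactly `Psi k d`, since a complete graph
cut into `(k - 1) / 2` and `(k + 1) / 2` vertices contributes total weight `1`. The bisection
attaining the bound takes the slices over the left subtree of the root of the first tree and
recursively bisects the slice over the root. -/

open Finset

/-- The complete binary tree on `k` vertices, for `k = 2 ^ l - 1` (that is, with `l` full levels),
with vertices in breadth-first order: the root is `0`, and the children of `u` are `2 * u + 1` and
`2 * u + 2`. -/
def completeBinaryTree (k : ℕ) : SimpleGraph (Fin k) where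
  Adj u v :=
    (v.val = 2 * u.val + 1 ∨ v.val = 2 * u.val + 2) ∨
      (u.val = 2 * v.val + 1 ∨ u.val = 2 * v.val + 2)
  symm := ⟨fun _ _ h => h.symm⟩
  loopless := ⟨fun u h => by omega⟩

/-- The Cartesian product of a family of graphs: two vertices are adjacent when they differ in
exactly one coordinate `i`, and there they are adjacent in `G i`. -/
def cartesianProduct {ι : Type*} {V : ι → Type*} (G : ∀ i, SimpleGraph (V i)) :
    SimpleGraph (∀ i, V i) where
  Adj x y := ∃ i, (G i).Adj (x i) (y i) ∧ ∀ j, j ≠ i → x j = y j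
  symm := ⟨fun _ _ ⟨i, hi, h⟩ => ⟨i, hi.symm, fun j hj => (h j hj).symm⟩⟩
  loopless := ⟨fun _ ⟨_, hi, _⟩ => hi.ne rfl⟩

/-- The `d`-dimensional mesh-connected trees: the Cartesian product of the complete binary trees
on `k i` vertices. -/
def meshConnectedTrees {d : ℕ} (k : Fin d → ℕ) : SimpleGraph (∀ i, Fin (k i)) :=
  cartesianProduct fun i => completeBinaryTree (k i)

/-- The set of edges of `G` with one endpoint in `S` and the other outside `S`. -/
def edgeBoundary {V : Type*} (G : SimpleGraph V) (S : Finset V) : Set (Sym2 V) :=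
  {e | e ∈ G.edgeSet ∧ ∃ u ∈ S, ∃ v ∉ S, e = s(u, v)}

/-- The sizes of the edge boundaries of the bisections of `G`, that is, of the sets of `⌊n / 2⌋`
vertices, where `n` is the number of vertices of `G`. -/
def bisectionSizes {V : Type*} [Fintype V] (G : SimpleGraph V) : Set ℕ :=
  {m | ∃ S : Finset V, S.card = Fintype.card V / 2 ∧ (edgeBoundary G S).ncard = m}

/-- The bisection width: the least number of edges whose removal separates a set of `⌊n / 2⌋`
vertices from the remaining ones. -/
noncomputable def bisectionWidth {V : Type*} [Fintype V] (G : SimpleGraph V) : ℕ :=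
  sInf (bisectionSizes G)

/-- The infimum in the definition of the bisection width is attained. -/
theorem isLeast_bisectionWidth {V : Type*} [Fintype V] (G : SimpleGraph V) :
    IsLeast (bisectionSizes G) (bisectionWidth G) := by
  have hne : (bisectionSizes G).Nonempty := by
    obtain ⟨S, _, hS⟩ := Finset.exists_subset_card_eq (s := (Finset.univ : Finset V))
      (n := Fintype.card V / 2) (by rw [Finset.card_univ]; exact Nat.div_le_self _ _)
    exact ⟨_, S, hS, rfl⟩
  exact ⟨Nat.sInf_mem hne, fun m hm => Nat.sInf_le hm⟩

/-- `Psi k a = ∑_{i = 1}^{a} ∏_{j = i + 1}^{d} k_j`, where the dimensions `1, …, d` are numbered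
`0, …, d - 1`. -/
def Psi {d : ℕ} (k : Fin d → ℕ) (a : ℕ) : ℕ :=
  ∑ i : Fin d with i.val < a, ∏ j : Fin d with i < j, k j

theorem index_lt {k N a y : ℕ} (ha : a < k) (hy : y < N) : a * N + y < k * N :=
  calc a * N + y < (a + 1) * N := by rw [add_one_mul]; omega
    _ ≤ k * N := Nat.mul_le_mul_right _ ha

theorem index_div {N y : ℕ} (hy : y < N) (a : ℕ) : (a * N + y) / N = a := by
  rw [mul_comm, Nat.mul_add_div (y.zero_le.trans_lt hy), Nat.div_eq_of_lt hy, add_zero]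

theorem exists_eq_mul_add {k N x : ℕ} (hk : 0 < k) (hx : x ≤ k * N) :
    ∃ q < k, ∃ r ≤ N, x = q * N + r := by
  rcases hx.lt_or_eq with hlt | rfl
  · have hN : 0 < N := Nat.pos_of_mul_pos_left (x.zero_le.trans_lt hlt)
    exact ⟨x / N, Nat.div_lt_of_lt_mul (by rwa [mul_comm]), x % N, (Nat.mod_lt _ hN).le,
      (Nat.div_add_mod' x N).symm⟩
  · exact ⟨k - 1, by omega, N, le_rfl, by rw [← add_one_mul, Nat.sub_one_add_one hk.ne']⟩

theorem sum_range_mul_eq {M : Type*} [AddCommMonoid M] (a b : ℕ) (F : ℕ → M) :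
    ∑ x ∈ range (a * b), F x = ∑ i ∈ range a, ∑ j ∈ range b, F (i * b + j) := by
  induction a with
  | zero => simp
  | succ a ih => rw [Nat.succ_mul, sum_range_add, ih, sum_range_succ]

theorem sum_range_le_of_le_one {f : ℕ → ℕ} (hf : ∀ x, f x ≤ 1) (N : ℕ) :
    ∑ x ∈ range N, f x ≤ N := by
  simpa using sum_le_card_nsmul (range N) f 1 fun x _ => hf x

/-- The indicator function of the first `m` natural numbers. -/
def initialSegment (m x : ℕ) : ℕ := if x < m then 1 else 0

theorem initialSegment_of_lt {m x : ℕ} (h : x < m) : initialSegment m x = 1 := if_pos h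

theorem initialSegment_of_le {m x : ℕ} (h : m ≤ x) : initialSegment m x = 0 := if_neg h.not_gt

theorem initialSegment_le_one (m x : ℕ) : initialSegment m x ≤ 1 := by
  unfold initialSegment; split_ifs <;> simp

theorem sum_initialSegment {m N : ℕ} (h : m ≤ N) : ∑ x ∈ range N, initialSegment m x = m := by
  have hfilter : {x ∈ range N | x < m} = range m := by ext x; simp; omega
  simp only [initialSegment, sum_boole, hfilter, card_range, Nat.cast_id]

theorem initialSegment_mul_initialSegment (m n x : ℕ) :
    initialSegment m x * initialSegment n x = initialSegment (min m n) x := by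
  unfold initialSegment; grind

/-- The total cut of a set of vertices in a product of graphs, where `cut k g` is the cut, in the
factor on `range k`, of the set with indicator function `g`. The vertices of the product of the
factors of orders `ks` are numbered lexicographically, the first coordinate being the most
significant. -/
def productEnergy {R : Type*} [AddCommMonoid R] (cut : ℕ → (ℕ → ℕ) → R) :
    List ℕ → (ℕ → ℕ) → R
  | [], _ => 0
  | k :: ks, f => ∑ a ∈ range k, productEnergy cut ks (fun y => f (a * ks.prod + y)) +
      ∑ y ∈ range ks.prod, cut k fun a => f (a * ks.prod + y)

section productEnergy

variable {R : Type*} [AddCommMonoid R] {cut : ℕ → (ℕ → ℕ) → R}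

theorem productEnergy_congr
    (hcut : ∀ k g g', (∀ a < k, g a = g' a) → cut k g = cut k g') {ks : List ℕ} {f g : ℕ → ℕ}
    (h : ∀ x < ks.prod, f x = g x) : productEnergy cut ks f = productEnergy cut ks g := by
  induction ks generalizing f g with
  | nil => rfl
  | cons k ks ih =>
    rw [List.prod_cons] at h
    refine congr_arg₂ (· + ·) (sum_congr rfl fun a ha => ?_) (sum_congr rfl fun y hy => ?_)
    · exact ih fun y hy => h _ (index_lt (mem_range.1 ha) hy)
    · exact hcut _ _ _ fun a ha => h _ (index_lt ha (mem_range.1 hy))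

theorem productEnergy_const {c : ℕ} (hcut : ∀ k, cut k (fun _ => c) = 0) (ks : List ℕ) :
    productEnergy cut ks (fun _ => c) = 0 := by
  induction ks with
  | nil => rfl
  | cons k ks ih => simp [productEnergy, ih, hcut]

theorem productEnergy_append_singleton (ks : List ℕ) (h : ℕ) (f : ℕ → ℕ) :
    productEnergy cut (ks ++ [h]) f =
      ∑ c ∈ range h, productEnergy cut ks (fun z => f (z * h + c)) +
        ∑ z ∈ range ks.prod, cut h fun c => f (z * h + c) := by
  induction ks generalizing f with
  | nil => simp [productEnergy]
  | cons k ks ih =>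
    have hindex (a z c : ℕ) : a * (ks.prod * h) + (z * h + c) = (a * ks.prod + z) * h + c := by
      ring
    simp only [List.cons_append, productEnergy, ih, List.prod_append, List.prod_cons,
      List.prod_nil, mul_one, sum_add_distrib, sum_range_mul_eq, hindex]
    rw [sum_comm (s := range h) (t := range k), sum_comm (s := range h)]
    abel

theorem map_productEnergy {S : Type*} [AddCommMonoid S] (φ : R →+ S) (ks : List ℕ) (f : ℕ → ℕ) :
    φ (productEnergy cut ks f) = productEnergy (fun k g => φ (cut k g)) ks f := by
  induction ks generalizing f with
  | nil => exact map_zero φ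
  | cons k ks ih => simp only [productEnergy, map_add, map_sum, ih]

theorem productEnergy_mono [PartialOrder R] [IsOrderedAddMonoid R] {cut' : ℕ → (ℕ → ℕ) → R}
    {ks : List ℕ} (hcut : ∀ k ∈ ks, ∀ g : ℕ → ℕ, (∀ a, g a ≤ 1) → cut k g ≤ cut' k g)
    {f : ℕ → ℕ} (hf : ∀ x, f x ≤ 1) : productEnergy cut ks f ≤ productEnergy cut' ks f := by
  induction ks generalizing f with
  | nil => exact le_rfl
  | cons k ks ih =>
    rw [List.forall_mem_cons] at hcut
    exact add_le_add (sum_le_sum fun a _ => ih hcut.2 fun _ => hf _)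
      (sum_le_sum fun y _ => hcut.1 _ fun _ => hf _)

end productEnergy

/-- The weight of an edge of the complete graph on `k` vertices, normalized so that for odd `k` a
bisection has total weight `1`. -/
def cliqueWeight (k : ℕ) : ℚ := 4 / ((k : ℚ) ^ 2 - 1)

/-- The total weight of the edges leaving a set of `c` vertices in the complete graph on `k`
vertices. -/
def cliqueCut (k c : ℕ) : ℚ := cliqueWeight k * (c * (k - c))

/-- The total weight of the edges leaving the set with indicator function `f` in the product of
the weighted complete graphs of orders `ks`. -/
def cliqueEnergy (ks : List ℕ) (f : ℕ → ℕ) : ℚ :=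
  productEnergy (fun k g => cliqueCut k (∑ a ∈ range k, g a)) ks f

theorem cliqueWeight_nonneg {k : ℕ} (hk : 1 ≤ k) : 0 ≤ cliqueWeight k := by
  have : (1 : ℚ) ≤ k := by exact_mod_cast hk
  exact div_nonneg (by norm_num) (by nlinarith)

theorem cliqueWeight_pos {k : ℕ} (hk : 2 ≤ k) : 0 < cliqueWeight k := by
  have : (2 : ℚ) ≤ k := by exact_mod_cast hk
  exact div_pos (by norm_num) (by nlinarith)

theorem cliqueWeight_anti {h k : ℕ} (hh : 2 ≤ h) (hhk : h ≤ k) :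
    cliqueWeight k ≤ cliqueWeight h := by
  have hh' : (2 : ℚ) ≤ h := by exact_mod_cast hh
  have hhk' : (h : ℚ) ≤ k := by exact_mod_cast hhk
  exact div_le_div_of_nonneg_left (by norm_num) (by nlinarith) (by nlinarith)

theorem cliqueCut_nonneg {k c : ℕ} (hc : c ≤ k) : 0 ≤ cliqueCut k c := by
  rcases Nat.eq_zero_or_pos k with rfl | hk
  · simp [cliqueCut, Nat.le_zero.1 hc]
  · have hc' : (c : ℚ) ≤ k := by exact_mod_cast hc
    exact mul_nonneg (cliqueWeight_nonneg hk) (mul_nonneg c.cast_nonneg (sub_nonneg.2 hc'))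

theorem sum_cliqueCut (k N : ℕ) (c : ℕ → ℕ) :
    ∑ y ∈ range N, cliqueCut k (c y) =
      cliqueWeight k * (k * (∑ y ∈ range N, c y : ℕ) - (∑ y ∈ range N, c y ^ 2 : ℕ)) := by
  simp only [cliqueCut, ← mul_sum]
  push_cast
  rw [mul_sum (a := (k : ℚ)), ← sum_sub_distrib]
  exact congr_arg _ (sum_congr rfl fun y _ => by ring)

theorem cliqueEnergy_cons (k : ℕ) (ks : List ℕ) (f : ℕ → ℕ) :
    cliqueEnergy (k :: ks) f =
      ∑ a ∈ range k, cliqueEnergy ks (fun y => f (a * ks.prod + y)) +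
        ∑ y ∈ range ks.prod, cliqueCut k (∑ a ∈ range k, f (a * ks.prod + y)) :=
  rfl

theorem cliqueEnergy_append_singleton (ks : List ℕ) (h : ℕ) (f : ℕ → ℕ) :
    cliqueEnergy (ks ++ [h]) f =
      ∑ c ∈ range h, cliqueEnergy ks (fun z => f (z * h + c)) +
        ∑ z ∈ range ks.prod, cliqueCut h (∑ c ∈ range h, f (z * h + c)) :=
  productEnergy_append_singleton ks h f

theorem cliqueEnergy_singleton (h : ℕ) (f : ℕ → ℕ) :
    cliqueEnergy [h] f = cliqueCut h (∑ c ∈ range h, f c) := by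
  simp [cliqueEnergy, productEnergy]

theorem cliqueEnergy_congr {ks : List ℕ} {f g : ℕ → ℕ} (h : ∀ x < ks.prod, f x = g x) :
    cliqueEnergy ks f = cliqueEnergy ks g :=
  productEnergy_congr (fun k _ _ hk => congr_arg (cliqueCut k)
    (sum_congr (s₁ := range k) rfl fun a ha => hk a (mem_range.1 ha))) h

theorem cliqueEnergy_initialSegment_zero (ks : List ℕ) :
    cliqueEnergy ks (initialSegment 0) = 0 :=
  (cliqueEnergy_congr fun x _ => initialSegment_of_le x.zero_le).trans <|
    productEnergy_const (fun k => by simp [cliqueCut]) ks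

theorem cliqueEnergy_initialSegment_prod (ks : List ℕ) :
    cliqueEnergy ks (initialSegment ks.prod) = 0 :=
  (cliqueEnergy_congr fun _ hx => initialSegment_of_lt hx).trans <|
    productEnergy_const (fun k => by simp [cliqueCut]) ks

/-- The sizes of the slices, each of capacity `N`, of a set consisting of the slices before `a`,
of `x` points of slice `a` and of `t` points of slice `a + 1`. -/
def sliceProfile (N a x t b : ℕ) : ℕ :=
  if b < a then N else if b = a then x else if b = a + 1 then t else 0

theorem sum_comp_sliceProfile {M : Type*} [AddCommMonoid M] {N a x t k : ℕ} (ha : a < k)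
    (hat : t ≠ 0 → a + 1 < k) (φ : ℕ → M) (hφ : φ 0 = 0) :
    ∑ b ∈ range k, φ (sliceProfile N a x t b) = a • φ N + φ x + φ t := by
  have hterm (b : ℕ) : φ (sliceProfile N a x t b) =
      (if b < a then φ N else 0) + (if b = a then φ x else 0) + if b = a + 1 then φ t else 0 := by
    unfold sliceProfile
    split_ifs <;> first | omega | simp [hφ]
  have hfilter : {b ∈ range k | b < a} = range a := by ext b; simp; omega
  have hlast : (if a + 1 ∈ range k then φ t else 0) = φ t := by
    rcases eq_or_ne t 0 with rfl | ht
    · simp [hφ]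
    · rw [if_pos (mem_range.2 (hat ht))]
  simp only [hterm, sum_add_distrib, sum_ite_eq', hlast, if_pos (mem_range.2 ha)]
  rw [← sum_filter, hfilter, sum_const, card_range]

theorem initialSegment_mul_add {N q r y : ℕ} (hr : r ≤ N) (hy : y < N) (b : ℕ) :
    initialSegment (q * N + r) (b * N + y) = initialSegment (sliceProfile N q r 0 b) y := by
  unfold sliceProfile
  rcases lt_trichotomy b q with hlt | rfl | hgt
  · rw [if_pos hlt, initialSegment_of_lt hy, initialSegment_of_lt]
    exact (index_lt hlt hy).trans_le (Nat.le_add_right _ _)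
  · simp [initialSegment]
  · rw [if_neg hgt.not_gt, if_neg hgt.ne', ite_self, initialSegment_of_le y.zero_le,
      initialSegment_of_le]
    have := Nat.mul_le_mul_right N hgt
    rw [Nat.succ_mul] at this
    omega

theorem sum_sq_sum_initialSegment {k N : ℕ} {m : ℕ → ℕ} (hm : ∀ b < k, m b ≤ N) :
    ∑ y ∈ range N, (∑ b ∈ range k, initialSegment (m b) y) ^ 2 =
      ∑ b ∈ range k, ∑ c ∈ range k, min (m b) (m c) := by
  simp only [sq, sum_mul_sum, initialSegment_mul_initialSegment]
  rw [sum_comm]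
  refine sum_congr rfl fun b hb => ?_
  rw [sum_comm]
  exact sum_congr rfl fun c _ =>
    sum_initialSegment ((min_le_left _ _).trans (hm b (mem_range.1 hb)))

theorem cliqueEnergy_cons_of_slices {k : ℕ} {ks : List ℕ} {f m : ℕ → ℕ}
    (hm : ∀ b < k, m b ≤ ks.prod)
    (hf : ∀ b < k, ∀ y < ks.prod, f (b * ks.prod + y) = initialSegment (m b) y) :
    cliqueEnergy (k :: ks) f = ∑ b ∈ range k, cliqueEnergy ks (initialSegment (m b)) +
      cliqueWeight k * (k * (∑ b ∈ range k, m b : ℕ) -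
        (∑ b ∈ range k, ∑ c ∈ range k, min (m b) (m c) : ℕ)) := by
  have hslices : ∀ b ∈ range k, cliqueEnergy ks (fun y => f (b * ks.prod + y)) =
      cliqueEnergy ks (initialSegment (m b)) := fun b hb =>
    cliqueEnergy_congr (hf b (mem_range.1 hb))
  have hcolumns : ∀ y ∈ range ks.prod, cliqueCut k (∑ b ∈ range k, f (b * ks.prod + y)) =
      cliqueCut k (∑ b ∈ range k, initialSegment (m b) y) := fun y hy =>
    congr_arg _ (sum_congr rfl fun b hb => hf b (mem_range.1 hb) y (mem_range.1 hy))
  have hsum : ∑ y ∈ range ks.prod, ∑ b ∈ range k, initialSegment (m b) y =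
      ∑ b ∈ range k, m b := by
    rw [sum_comm]
    exact sum_congr rfl fun b hb => sum_initialSegment (hm b (mem_range.1 hb))
  rw [cliqueEnergy_cons, sum_congr rfl hslices, sum_congr rfl hcolumns, sum_cliqueCut, hsum,
    sum_sq_sum_initialSegment hm]

theorem sum_sum_min_sliceProfile {N a x t k : ℕ} (hx : x ≤ N) (ht : t ≤ N) (ha : a < k)
    (hat : t ≠ 0 → a + 1 < k) :
    ∑ b ∈ range k, ∑ c ∈ range k, min (sliceProfile N a x t b) (sliceProfile N a x t c) =
      a * (a * N + x + t) + (a * x + x + min x t) + (a * t + min x t + t) := by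
  simp only [sum_comp_sliceProfile ha hat (min _) (Nat.min_zero _)]
  rw [sum_comp_sliceProfile ha hat (fun v => a • min v N + min v x + min v t) (by simp)]
  simp only [min_self, min_eq_left hx, min_eq_left ht, min_eq_right hx, min_eq_right ht,
    min_comm t x, smul_eq_mul]

theorem cliqueEnergy_cons_of_sliceProfile {k : ℕ} {ks : List ℕ} {f : ℕ → ℕ} {a x t : ℕ}
    (ha : a < k) (hat : t ≠ 0 → a + 1 < k) (hx : x ≤ ks.prod) (ht : t ≤ ks.prod)
    (hf : ∀ b < k, ∀ y < ks.prod,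
      f (b * ks.prod + y) = initialSegment (sliceProfile ks.prod a x t b) y) :
    cliqueEnergy (k :: ks) f =
      cliqueEnergy ks (initialSegment x) + cliqueEnergy ks (initialSegment t) +
        cliqueWeight k * ((k - a) * a * ks.prod + (k - 2 * a - 1) * (x + t) -
          2 * (min x t : ℕ)) := by
  have hprofile (b : ℕ) : sliceProfile ks.prod a x t b ≤ ks.prod := by
    unfold sliceProfile; split_ifs <;> simp [*]
  rw [cliqueEnergy_cons_of_slices (fun b _ => hprofile b) hf, sum_sum_min_sliceProfile hx ht ha hat,
    sum_comp_sliceProfile ha hat (fun v => cliqueEnergy ks (initialSegment v))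
      (cliqueEnergy_initialSegment_zero ks), sum_comp_sliceProfile ha hat (fun v => v) rfl,
    cliqueEnergy_initialSegment_prod, smul_zero, zero_add]
  simp only [smul_eq_mul, Nat.cast_add, Nat.cast_mul]
  ring

theorem cliqueEnergy_cons_initialSegment {k : ℕ} {ks : List ℕ} {q r : ℕ} (hq : q < k)
    (hr : r ≤ ks.prod) :
    cliqueEnergy (k :: ks) (initialSegment (q * ks.prod + r)) =
      cliqueEnergy ks (initialSegment r) +
        cliqueWeight k * ((k - q) * q * ks.prod + (k - 2 * q - 1) * r) := by
  rw [cliqueEnergy_cons_of_sliceProfile hq (fun h => (h rfl).elim) hr (Nat.zero_le _)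
    fun b _ y hy => initialSegment_mul_add hr hy b, cliqueEnergy_initialSegment_zero]
  simp

theorem cliqueEnergy_initialSegment_prod_sub (ks : List ℕ) {x : ℕ} (hx : x ≤ ks.prod) :
    cliqueEnergy ks (initialSegment (ks.prod - x)) = cliqueEnergy ks (initialSegment x) := by
  induction ks generalizing x with
  | nil => rfl
  | cons k ks ih =>
    rw [List.prod_cons] at hx ⊢
    rcases Nat.eq_zero_or_pos k with rfl | hk
    · obtain rfl : x = 0 := by omega
      simp only [zero_mul, Nat.sub_zero]
    obtain ⟨q, hq, r, hr, rfl⟩ := exists_eq_mul_add hk hx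
    obtain ⟨p, rfl⟩ : ∃ p, k = q + p + 1 := ⟨k - q - 1, by omega⟩
    have hcomplement : (q + p + 1) * ks.prod - (q * ks.prod + r) =
        p * ks.prod + (ks.prod - r) := by
      rw [add_mul, add_mul]; omega
    rw [hcomplement, cliqueEnergy_cons_initialSegment (by omega) (Nat.sub_le _ _),
      cliqueEnergy_cons_initialSegment hq hr, ih hr, Nat.cast_sub hr, Nat.cast_add_one,
      Nat.cast_add]
    ring

theorem le_prod_append_singleton {ks : List ℕ} (hks : ∀ j ∈ ks, 1 ≤ j) (h : ℕ) :
    h ≤ (ks ++ [h]).prod := by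
  rw [List.prod_append, List.prod_singleton]
  exact Nat.le_mul_of_pos_left _ (List.prod_pos hks)

theorem cliqueEnergy_append_singleton_initialSegment {ks : List ℕ} (hks : ∀ j ∈ ks, 1 ≤ j)
    {h x : ℕ} (hx : x ≤ h) :
    cliqueEnergy (ks ++ [h]) (initialSegment x) =
      x * (ks.map fun j => cliqueCut j 1).sum + cliqueCut h x := by
  induction ks with
  | nil => simp [cliqueEnergy_singleton, sum_initialSegment hx]
  | cons k ks ih =>
    rw [List.forall_mem_cons] at hks
    have hslice := cliqueEnergy_cons_initialSegment (ks := ks ++ [h]) (q := 0) hks.1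
      (hx.trans (le_prod_append_singleton hks.2 h))
    have hsingle : cliqueCut k 1 = cliqueWeight k * (k - 1) := by simp [cliqueCut]
    rw [zero_mul, zero_add, ih hks.2] at hslice
    rw [List.cons_append, hslice, List.map_cons, List.sum_cons, hsingle]
    push_cast
    ring

theorem two_mul_cliqueWeight_le {ks : List ℕ} (hks : ∀ j ∈ ks, 1 ≤ j) {k h s t : ℕ}
    (hh : 2 ≤ h) (hhk : h ≤ k) (hts : t ≤ s) (hst : s + t ≤ h) :
    2 * t * cliqueWeight k ≤ cliqueEnergy (ks ++ [h]) (initialSegment s) +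
      cliqueEnergy (ks ++ [h]) (initialSegment t) -
        cliqueEnergy (ks ++ [h]) (initialSegment (s - t)) := by
  have hgap : (t : ℚ) ≤ t * (h - s) := by
    rcases Nat.eq_zero_or_pos t with rfl | ht
    · simp
    · have : (s : ℚ) + 1 ≤ h := by exact_mod_cast (by omega : s + 1 ≤ h)
      nlinarith [t.cast_nonneg (α := ℚ)]
  have hsum : cliqueEnergy (ks ++ [h]) (initialSegment s) +
      cliqueEnergy (ks ++ [h]) (initialSegment t) -
        cliqueEnergy (ks ++ [h]) (initialSegment (s - t)) =
      2 * t * (ks.map fun j => cliqueCut j 1).sum + 2 * (t * (h - s)) * cliqueWeight h := by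
    rw [cliqueEnergy_append_singleton_initialSegment hks (by omega),
      cliqueEnergy_append_singleton_initialSegment hks (by omega),
      cliqueEnergy_append_singleton_initialSegment hks (by omega), Nat.cast_sub hts]
    simp only [cliqueCut, Nat.cast_sub hts]
    ring
  have hcuts : 0 ≤ (ks.map fun j => cliqueCut j 1).sum :=
    List.sum_nonneg (by simpa using fun j hj => cliqueCut_nonneg (hks j hj))
  have hweight : 2 * t * cliqueWeight k ≤ 2 * (t * (h - s)) * cliqueWeight h := by
    rw [mul_assoc, mul_assoc]
    have hanti := cliqueWeight_anti hh hhk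
    have hnonneg := cliqueWeight_nonneg (k := k) (by omega)
    gcongr
    exact t.cast_nonneg.trans hgap
  rw [hsum]
  have : 0 ≤ 2 * (t : ℚ) * (ks.map fun j => cliqueCut j 1).sum := by positivity
  linarith

theorem sum_mul_initialSegment_lt {f w : ℕ → ℕ} (hf : ∀ x, f x ≤ 1) (hw : StrictMono w) {N : ℕ}
    (hne : ∃ y < N, f y ≠ initialSegment (∑ x ∈ range N, f x) y) :
    ∑ y ∈ range N, w y * initialSegment (∑ x ∈ range N, f x) y < ∑ y ∈ range N, w y * f y := by
  have hsum := sum_initialSegment (sum_range_le_of_le_one hf N)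
  set m := ∑ x ∈ range N, f x with hm
  have hterm (y : ℕ) : 0 ≤ (2 * (w y : ℤ) - (2 * w m - 1)) * (f y - initialSegment m y) ∧
      (f y ≠ initialSegment m y →
        0 < (2 * (w y : ℤ) - (2 * w m - 1)) * (f y - initialSegment m y)) := by
    have hfy := hf y
    rcases lt_or_ge y m with hlt | hge
    · have := hw hlt
      rw [initialSegment_of_lt hlt]
      exact ⟨mul_nonneg_of_nonpos_of_nonpos (by omega) (by omega),
        fun h => mul_pos_of_neg_of_neg (by omega) (by omega)⟩
    · have := hw.monotone hge
      rw [initialSegment_of_le hge]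
      exact ⟨mul_nonneg (by omega) (by omega), fun h => mul_pos (by omega) (by omega)⟩
  have hpos : 0 < ∑ y ∈ range N,
      (2 * (w y : ℤ) - (2 * w m - 1)) * (f y - initialSegment m y) := by
    obtain ⟨y, hy, hfy⟩ := hne
    exact sum_pos' (fun y _ => (hterm y).1) ⟨y, mem_range.2 hy, (hterm y).2 hfy⟩
  have hsum' : ∑ y ∈ range N, (f y : ℤ) = ∑ y ∈ range N, (initialSegment m y : ℤ) := by
    exact_mod_cast hm.symm.trans hsum.symm
  simp only [sub_mul _ (2 * (w m : ℤ) - 1), mul_sub, mul_assoc, sum_sub_distrib, ← mul_sum, hsum',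
    sub_self, sub_zero] at hpos
  zify
  linarith

/-- The set with the same number of points in each row as the set with indicator function `F`, the
first index being the row and the second one ranging over `range N`, in which the points of each
row form an initial segment. -/
def compressRows (N : ℕ) (F : ℕ → ℕ → ℕ) (a : ℕ) : ℕ → ℕ :=
  initialSegment (∑ y ∈ range N, F a y)

section compressRows

variable {F : ℕ → ℕ → ℕ} (hF : ∀ a y, F a y ≤ 1)
include hF

theorem sum_compressRows (N a : ℕ) :
    ∑ y ∈ range N, compressRows N F a y = ∑ y ∈ range N, F a y :=
  sum_initialSegment (sum_range_le_of_le_one (hF a) N)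

theorem sum_sum_mul_compressRows_lt {w : ℕ → ℕ → ℕ} (hw : ∀ a, StrictMono (w a)) {k N : ℕ}
    (hne : ∃ a < k, ∃ y < N, F a y ≠ compressRows N F a y) :
    ∑ a ∈ range k, ∑ y ∈ range N, w a y * compressRows N F a y <
      ∑ a ∈ range k, ∑ y ∈ range N, w a y * F a y := by
  have hrow (a : ℕ) (h : ∃ y < N, F a y ≠ compressRows N F a y) :
      ∑ y ∈ range N, w a y * compressRows N F a y < ∑ y ∈ range N, w a y * F a y :=
    sum_mul_initialSegment_lt (hF a) (hw a) h
  obtain ⟨a, ha, hne⟩ := hne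
  refine sum_lt_sum (fun b _ => ?_) ⟨a, mem_range.2 ha, hrow a hne⟩
  by_cases hb : ∃ y < N, F b y ≠ compressRows N F b y
  · exact (hrow b hb).le
  · push Not at hb
    exact (sum_congr rfl fun y hy => by rw [hb y (mem_range.1 hy)]).ge

theorem sum_sq_sum_le_sum_sq_sum_compressRows (k N : ℕ) :
    ∑ y ∈ range N, (∑ a ∈ range k, F a y) ^ 2 ≤
      ∑ y ∈ range N, (∑ a ∈ range k, compressRows N F a y) ^ 2 := by
  have hoverlap (a b : ℕ) : ∑ y ∈ range N, F a y * F b y ≤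
      min (∑ y ∈ range N, F a y) (∑ y ∈ range N, F b y) :=
    le_min (sum_le_sum fun y _ => mul_le_of_le_one_right (Nat.zero_le _) (hF b y))
      (sum_le_sum fun y _ => mul_le_of_le_one_left (Nat.zero_le _) (hF a y))
  calc ∑ y ∈ range N, (∑ a ∈ range k, F a y) ^ 2
      = ∑ a ∈ range k, ∑ b ∈ range k, ∑ y ∈ range N, F a y * F b y := by
        simp only [sq, sum_mul_sum]
        rw [sum_comm]
        exact sum_congr rfl fun a _ => sum_comm
    _ ≤ ∑ a ∈ range k, ∑ b ∈ range k,
          min (∑ y ∈ range N, F a y) (∑ y ∈ range N, F b y) :=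
        sum_le_sum fun a _ => sum_le_sum fun b _ => hoverlap a b
    _ = ∑ y ∈ range N, (∑ a ∈ range k, compressRows N F a y) ^ 2 :=
        (sum_sq_sum_initialSegment fun a _ => sum_range_le_of_le_one (hF a) N).symm

theorem sum_cliqueCut_compressRows_le {k : ℕ} (hk : 1 ≤ k) (N : ℕ) :
    ∑ y ∈ range N, cliqueCut k (∑ a ∈ range k, compressRows N F a y) ≤
      ∑ y ∈ range N, cliqueCut k (∑ a ∈ range k, F a y) := by
  have hsum : ∑ y ∈ range N, ∑ a ∈ range k, compressRows N F a y =
      ∑ y ∈ range N, ∑ a ∈ range k, F a y := by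
    rw [sum_comm, sum_comm (s := range N)]
    exact sum_congr rfl fun a _ => sum_compressRows hF N a
  rw [sum_cliqueCut, sum_cliqueCut, hsum]
  refine mul_le_mul_of_nonneg_left (sub_le_sub_left ?_ _) (cliqueWeight_nonneg hk)
  exact_mod_cast sum_sq_sum_le_sum_sq_sum_compressRows hF k N

end compressRows

/-- The isoperimetric property of the product of the weighted complete graphs of orders `ks`: the
lexicographic initial segments have the least energy among the sets of their size. -/
def InitialSegmentsOptimal (ks : List ℕ) : Prop :=
  ∀ f : ℕ → ℕ, (∀ x, f x ≤ 1) →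
    cliqueEnergy ks (initialSegment (∑ x ∈ range ks.prod, f x)) ≤ cliqueEnergy ks f

theorem exists_slice_compression {k : ℕ} (hk : 1 ≤ k) {ks : List ℕ}
    (hks : InitialSegmentsOptimal ks) {f : ℕ → ℕ} (hf : ∀ x, f x ≤ 1)
    (hne : ∃ a < k, ∃ y < ks.prod, f (a * ks.prod + y) ≠
      compressRows ks.prod (fun a y => f (a * ks.prod + y)) a y) :
    ∃ f' : ℕ → ℕ, (∀ x, f' x ≤ 1) ∧
      ∑ x ∈ range (k * ks.prod), f' x = ∑ x ∈ range (k * ks.prod), f x ∧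
      ∑ x ∈ range (k * ks.prod), x * f' x < ∑ x ∈ range (k * ks.prod), x * f x ∧
      cliqueEnergy (k :: ks) f' ≤ cliqueEnergy (k :: ks) f := by
  set N := ks.prod
  set F : ℕ → ℕ → ℕ := fun a y => f (a * N + y)
  have hF (a y : ℕ) : F a y ≤ 1 := hf _
  let f' (x : ℕ) : ℕ := compressRows N F (x / N) (x % N)
  have hf' (a : ℕ) {y : ℕ} (hy : y ∈ range N) : f' (a * N + y) = compressRows N F a y := by
    rw [mem_range] at hy
    simp only [f', Nat.mul_add_mod_of_lt hy, index_div hy]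
  refine ⟨f', fun _ => initialSegment_le_one _ _, ?_, ?_, ?_⟩
  · rw [sum_range_mul_eq, sum_range_mul_eq]
    exact sum_congr rfl fun a _ =>
      (sum_congr rfl fun y hy => hf' a hy).trans (sum_compressRows hF N a)
  · rw [sum_range_mul_eq, sum_range_mul_eq,
      sum_congr rfl fun a _ => sum_congr rfl fun y hy => by rw [hf' a hy]]
    exact sum_sum_mul_compressRows_lt hF (fun a => strictMono_id.const_add (a * N)) hne
  · rw [cliqueEnergy_cons, cliqueEnergy_cons]
    refine add_le_add (sum_le_sum fun a _ => ?_) ?_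
    · rw [cliqueEnergy_congr fun y hy => hf' a (mem_range.2 hy)]
      exact hks _ (hF a)
    · rw [sum_congr rfl fun y hy => by rw [sum_congr rfl fun a _ => hf' a hy]]
      exact sum_cliqueCut_compressRows_le hF hk N

theorem exists_fibre_compression {h : ℕ} (hh : 1 ≤ h) {ks : List ℕ}
    (hks : InitialSegmentsOptimal ks) {f : ℕ → ℕ} (hf : ∀ x, f x ≤ 1)
    (hne : ∃ c < h, ∃ z < ks.prod, f (z * h + c) ≠
      compressRows ks.prod (fun c z => f (z * h + c)) c z) :
    ∃ f' : ℕ → ℕ, (∀ x, f' x ≤ 1) ∧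
      ∑ x ∈ range (ks.prod * h), f' x = ∑ x ∈ range (ks.prod * h), f x ∧
      ∑ x ∈ range (ks.prod * h), x * f' x < ∑ x ∈ range (ks.prod * h), x * f x ∧
      cliqueEnergy (ks ++ [h]) f' ≤ cliqueEnergy (ks ++ [h]) f := by
  set N := ks.prod
  set F : ℕ → ℕ → ℕ := fun c z => f (z * h + c)
  have hF (c z : ℕ) : F c z ≤ 1 := hf _
  let f' (x : ℕ) : ℕ := compressRows N F (x % h) (x / h)
  have hf' {c : ℕ} (hc : c ∈ range h) (z : ℕ) : f' (z * h + c) = compressRows N F c z := by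
    rw [mem_range] at hc
    simp only [f', Nat.mul_add_mod_of_lt hc, index_div hc]
  refine ⟨f', fun _ => initialSegment_le_one _ _, ?_, ?_, ?_⟩
  · rw [sum_range_mul_eq, sum_range_mul_eq, sum_comm, sum_comm (s := range N)]
    exact sum_congr rfl fun c hc =>
      (sum_congr rfl fun z _ => hf' hc z).trans (sum_compressRows hF N c)
  · rw [sum_range_mul_eq, sum_range_mul_eq, sum_comm, sum_comm (s := range N),
      sum_congr rfl fun c hc => sum_congr rfl fun z _ => by rw [hf' hc]]
    exact sum_sum_mul_compressRows_lt (w := fun c z => z * h + c) hF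
      (fun c => (strictMono_id.mul_const hh).add_const c) hne
  · rw [cliqueEnergy_append_singleton, cliqueEnergy_append_singleton]
    refine add_le_add (sum_le_sum fun c hc => ?_) ?_
    · rw [cliqueEnergy_congr fun z _ => hf' hc z]
      exact hks _ (hF c)
    · rw [sum_congr rfl fun z _ => by rw [sum_congr rfl fun c hc => hf' hc z]]
      exact sum_cliqueCut_compressRows_le hF hh N

theorem exists_compressed {k h : ℕ} (hk : 1 ≤ k) (hh : 1 ≤ h) {ks : List ℕ}
    (htail : InitialSegmentsOptimal (ks ++ [h])) (hinit : InitialSegmentsOptimal (k :: ks))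
    {f : ℕ → ℕ} (hf : ∀ x, f x ≤ 1) :
    ∃ g : ℕ → ℕ, (∀ x, g x ≤ 1) ∧
      ∑ x ∈ range (k :: (ks ++ [h])).prod, g x = ∑ x ∈ range (k :: (ks ++ [h])).prod, f x ∧
      cliqueEnergy (k :: (ks ++ [h])) g ≤ cliqueEnergy (k :: (ks ++ [h])) f ∧
      (∀ a < k, ∀ y < (ks ++ [h]).prod, g (a * (ks ++ [h]).prod + y) =
        compressRows (ks ++ [h]).prod (fun a y => g (a * (ks ++ [h]).prod + y)) a y) ∧
      ∀ c < h, ∀ z < (k :: ks).prod, g (z * h + c) =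
        compressRows (k :: ks).prod (fun c z => g (z * h + c)) c z := by
  have hprod : (k :: (ks ++ [h])).prod = (k :: ks).prod * h := by
    rw [← List.cons_append, List.prod_append, List.prod_singleton]
  have hprod' : (k :: (ks ++ [h])).prod = k * (ks ++ [h]).prod := List.prod_cons
  -- A compression that changes the set lowers `∑ x, x * f x`, so alternating the two terminates.
  induction hrank : ∑ x ∈ range (k :: (ks ++ [h])).prod, x * f x using
    Nat.strong_induction_on generalizing f with
  | _ n ih =>
    subst hrank
    by_contra! hcon
    obtain ⟨f', hf', hsum, hrank, henergy⟩ : ∃ f' : ℕ → ℕ, (∀ x, f' x ≤ 1) ∧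
        ∑ x ∈ range (k :: (ks ++ [h])).prod, f' x = ∑ x ∈ range (k :: (ks ++ [h])).prod, f x ∧
        ∑ x ∈ range (k :: (ks ++ [h])).prod, x * f' x <
          ∑ x ∈ range (k :: (ks ++ [h])).prod, x * f x ∧
        cliqueEnergy (k :: (ks ++ [h])) f' ≤ cliqueEnergy (k :: (ks ++ [h])) f := by
      by_cases hslices : ∀ a < k, ∀ y < (ks ++ [h]).prod, f (a * (ks ++ [h]).prod + y) =
          compressRows (ks ++ [h]).prod (fun a y => f (a * (ks ++ [h]).prod + y)) a y
      · rw [hprod]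
        exact exists_fibre_compression hh hinit hf (hcon f hf rfl le_rfl hslices)
      · push Not at hslices
        rw [hprod']
        exact exists_slice_compression hk htail hf hslices
    obtain ⟨g, hg, hgsum, hgenergy, hgslices, hgfibres⟩ := ih _ hrank hf' rfl
    obtain ⟨c, hc, z, hz, hne⟩ :=
      hcon g hg (hgsum.trans hsum) (hgenergy.trans henergy) hgslices
    exact hne (hgfibres c hc z hz)

theorem exists_sliceProfile_of_overlap {k P h : ℕ} (hk : 0 < k) (hP : 2 ≤ P) {m : ℕ → ℕ}
    (hm : ∀ b < k, m b ≤ P * h)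
    (hoverlap : ∀ a b, a < b → b < k → m b ≠ 0 → (P - 1) * h + min (m b) h ≤ m a) :
    ∃ a < k, ∃ s ≤ P * h, ∃ t, (t ≠ 0 → a + 1 < k ∧ s + t ≤ h) ∧
      ∀ b < k, m b = sliceProfile (P * h) a (P * h - s) t b := by
  have hcap : P * h = (P - 1) * h + h := by rw [← Nat.succ_mul]; congr; omega
  have hrows : h ≤ (P - 1) * h := Nat.le_mul_of_pos_left _ (by omega)
  by_cases hfull : ∀ b < k, m b = P * h
  · refine ⟨k - 1, by omega, 0, Nat.zero_le _, 0, fun h => (h rfl).elim, fun b hb => ?_⟩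
    rw [hfull b hb]
    unfold sliceProfile
    split_ifs <;> omega
  push Not at hfull
  obtain ⟨hak, hane⟩ := Nat.find_spec hfull
  have hfirst (b : ℕ) := Nat.find_min hfull (m := b)
  set a := Nat.find hfull
  have hbefore : ∀ b < a, m b = P * h := fun b hb => by
    have := hfirst b hb
    push Not at this
    exact this (hb.trans hak)
  have ha := hm a hak
  have hafter : ∀ b, a + 1 < b → b < k → m b = 0 := by
    intro b hab hb
    by_contra hne
    have hnext := hoverlap (a + 1) b hab hb hne
    have := hoverlap a (a + 1) (Nat.lt_succ_self a) (by omega) (by omega)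
    omega
  refine ⟨a, hak, P * h - m a, Nat.sub_le _ _, if a + 1 < k then m (a + 1) else 0, ?_, ?_⟩
  · intro hne
    split_ifs at hne ⊢ with hnext
    · have := hoverlap a (a + 1) (Nat.lt_succ_self a) hnext hne
      exact ⟨hnext, by omega⟩
    · exact (hne rfl).elim
  · intro b hb
    unfold sliceProfile
    split_ifs with hlt heq hsucc hnext
    · exact hbefore b hlt
    · rw [heq]; omega
    · rw [hsucc]
    · omega
    · exact hafter b (by omega) hb

theorem slice_overlap {k P h : ℕ} {f m : ℕ → ℕ}
    (hslices : ∀ a < k, ∀ y < P * h, f (a * (P * h) + y) = initialSegment (m a) y) {n : ℕ → ℕ}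
    (hfibres : ∀ c < h, ∀ z < k * P, f (z * h + c) = initialSegment (n c) z) (hP : 1 ≤ P)
    {a b : ℕ} (hab : a < b) (hb : b < k) (hne : m b ≠ 0) :
    (P - 1) * h + min (m b) h ≤ m a := by
  rcases Nat.eq_zero_or_pos h with rfl | hh
  · simp
  obtain ⟨c, hc⟩ : ∃ c, min (m b) h = c + 1 := ⟨min (m b) h - 1, by omega⟩
  have hindex (a j : ℕ) : a * (P * h) + (j * h + c) = (a * P + j) * h + c := by ring
  have hmem : f (b * (P * h) + (0 * h + c)) = 1 := by
    rw [zero_mul, zero_add, hslices b hb c (by have := Nat.le_mul_of_pos_left h hP; omega),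
      initialSegment_of_lt (by omega)]
  rw [hindex, hfibres c (by omega) _ (index_lt hb (by omega))] at hmem
  have hlt : b * P + 0 < n c := by
    by_contra! hle
    rw [initialSegment_of_le hle] at hmem
    exact zero_ne_one hmem
  have hz : a * P + (P - 1) < b * P := index_lt hab (by omega)
  have hmem' : f (a * (P * h) + ((P - 1) * h + c)) = 1 := by
    rw [hindex, hfibres c (by omega) _ (index_lt (hab.trans hb) (by omega)),
      initialSegment_of_lt (by omega)]
  rw [hslices a (hab.trans hb) _ (index_lt (by omega) (by omega))] at hmem'
  by_contra! hlt'
  rw [initialSegment_of_le (by omega)] at hmem'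
  exact zero_ne_one hmem'

theorem cliqueEnergy_initialSegment_le_of_sliceProfile {ks : List ℕ} (hks : ∀ j ∈ ks, 1 ≤ j)
    {k h : ℕ} (hh : 2 ≤ h) (hhk : h ≤ k) {f : ℕ → ℕ} {a s t : ℕ} (ha : a < k)
    (hs : s ≤ (ks ++ [h]).prod) (hst : t ≠ 0 → a + 1 < k ∧ s + t ≤ h)
    (hf : ∀ b < k, ∀ y < (ks ++ [h]).prod, f (b * (ks ++ [h]).prod + y) =
      initialSegment (sliceProfile (ks ++ [h]).prod a ((ks ++ [h]).prod - s) t b) y) :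
    cliqueEnergy (k :: (ks ++ [h]))
        (initialSegment (a * (ks ++ [h]).prod + ((ks ++ [h]).prod - s) + t)) ≤
      cliqueEnergy (k :: (ks ++ [h])) f := by
  have hhN := le_prod_append_singleton hks h
  have hgain {s t : ℕ} := two_mul_cliqueWeight_le (s := s) (t := t) hks hh hhk
  have hcomplement {x : ℕ} := cliqueEnergy_initialSegment_prod_sub (ks ++ [h]) (x := x)
  set N := (ks ++ [h]).prod with hN
  have htN : t ≤ N := by
    rcases eq_or_ne t 0 with rfl | ht
    · exact Nat.zero_le _
    · have := (hst ht).2; omega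
  rw [cliqueEnergy_cons_of_sliceProfile ha (fun ht => (hst ht).1) (Nat.sub_le _ _) htN hf,
    hcomplement hs]
  rcases eq_or_ne t 0 with rfl | ht
  · rw [add_zero, cliqueEnergy_cons_initialSegment ha (Nat.sub_le _ _), hcomplement hs,
      cliqueEnergy_initialSegment_zero]
    simp
  obtain ⟨hak, hle⟩ := hst ht
  rw [← hN, min_eq_right (by omega), Nat.cast_sub hs]
  rcases le_total t s with hts | hst
  · have hsize : a * N + (N - s) + t = a * N + (N - (s - t)) := by omega
    rw [hsize, cliqueEnergy_cons_initialSegment ha (Nat.sub_le _ _), hcomplement (by omega),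
      ← hN, Nat.cast_sub (by omega), Nat.cast_sub hts]
    linear_combination hgain hts hle
  · have hsize : a * N + (N - s) + t = (a + 1) * N + (t - s) := by rw [add_one_mul]; omega
    have hgain' := hgain hst (by omega)
    rw [hsize, cliqueEnergy_cons_initialSegment hak (by omega), ← hN, Nat.cast_sub hst,
      Nat.cast_add_one]
    linear_combination hgain'

theorem InitialSegmentsOptimal.cons_append_singleton {k h : ℕ} (hh : 2 ≤ h) (hhk : h ≤ k)
    {ks : List ℕ} (hks : ∀ j ∈ ks, 1 ≤ j) (hprod : 2 ≤ ks.prod)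
    (htail : InitialSegmentsOptimal (ks ++ [h])) (hinit : InitialSegmentsOptimal (k :: ks)) :
    InitialSegmentsOptimal (k :: (ks ++ [h])) := by
  intro f hf
  obtain ⟨g, hg, hsum, henergy, hslices, hfibres⟩ :=
    exists_compressed (by omega) (by omega) htail hinit hf
  rw [← hsum]
  refine le_trans ?_ henergy
  have hN : (ks ++ [h]).prod = ks.prod * h := by rw [List.prod_append, List.prod_singleton]
  set m : ℕ → ℕ := fun a => ∑ y ∈ range (ks ++ [h]).prod, g (a * (ks ++ [h]).prod + y)
  obtain ⟨a, ha, s, hs, t, hst, hprofile⟩ := exists_sliceProfile_of_overlap (m := m) (k := k)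
    (by omega) hprod (fun b _ => (sum_range_le_of_le_one (fun _ => hg _) _).trans_eq hN)
    fun a b hab hb hne => slice_overlap (n := fun c => ∑ z ∈ range (k :: ks).prod, g (z * h + c))
      (by rw [← hN]; exact hslices) (by rw [← List.prod_cons]; exact hfibres) (by omega) hab hb hne
  rw [← hN] at hs hprofile
  have hsize : ∑ x ∈ range (k :: (ks ++ [h])).prod, g x =
      a * (ks ++ [h]).prod + ((ks ++ [h]).prod - s) + t := by
    rw [List.prod_cons, sum_range_mul_eq]
    exact (sum_congr rfl fun b hb => hprofile b (mem_range.1 hb)).trans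
      (sum_comp_sliceProfile ha (fun ht => (hst ht).1) id rfl)
  rw [hsize]
  refine cliqueEnergy_initialSegment_le_of_sliceProfile hks hh hhk ha hs hst fun b hb y hy => ?_
  rw [hslices b hb y hy, ← hprofile b hb]
  rfl

theorem exists_between_sum_eq {ι : Type*} {T : Finset ι} {l u : ι → ℕ}
    (hlu : ∀ t ∈ T, l t ≤ u t) {ρ : ℕ} (hl : ∑ t ∈ T, l t ≤ ρ) (hu : ρ ≤ ∑ t ∈ T, u t) :
    ∃ x : ι → ℕ, (∀ t ∈ T, l t ≤ x t ∧ x t ≤ u t) ∧ ∑ t ∈ T, x t = ρ := by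
  classical
  induction ρ, hl using Nat.le_induction with
  | base => exact ⟨l, fun t ht => ⟨le_rfl, hlu t ht⟩, rfl⟩
  | succ ρ _ ih =>
    obtain ⟨x, hx, rfl⟩ := ih (by omega)
    obtain ⟨a, ha, hlt⟩ := exists_lt_of_sum_lt (Nat.lt_of_succ_le hu)
    refine ⟨x + Pi.single a 1, fun t ht => ?_, by simp [sum_add_distrib, ha]⟩
    have := hx t ht
    rcases eq_or_ne t a with rfl | hta
    · simp only [Pi.add_apply, Pi.single_eq_same]
      omega
    · simpa [Pi.single_eq_of_ne hta] using this

/-- The number of edges of the complete graph on `h` vertices between a set of vertices and its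
complement depends, up to the symmetry `v ↦ h - v`, only on the residue `v` of the size of the set;
hence it is encoded as a function on `ZMod h`. -/
def cyclicCut (h : ℕ) (v : ZMod h) : ℤ := v.valMinAbs.natAbs * (h - v.valMinAbs.natAbs)

section CyclicCut

variable {h : ℕ}

theorem cyclicCut_neg (v : ZMod h) : cyclicCut h (-v) = cyclicCut h v := by
  simp only [cyclicCut, ZMod.natAbs_valMinAbs_neg]

theorem four_mul_cyclicCut_le (v : ZMod h) : 4 * cyclicCut h v ≤ (h : ℤ) ^ 2 := by
  unfold cyclicCut
  nlinarith [sq_nonneg ((h : ℤ) - 2 * v.valMinAbs.natAbs)]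

theorem natAbs_valMinAbs_pos {v : ZMod h} (hv : v ≠ 0) : 1 ≤ v.valMinAbs.natAbs := by
  rwa [Nat.one_le_iff_ne_zero, Int.natAbs_ne_zero, Ne, ZMod.valMinAbs_eq_zero]

theorem natAbs_valMinAbs_sum_le {ι : Type*} (T : Finset ι) (c : ι → ZMod h) :
    (∑ t ∈ T, c t).valMinAbs.natAbs ≤ ∑ t ∈ T, (c t).valMinAbs.natAbs :=
  le_sum_of_subadditive (fun v : ZMod h => v.valMinAbs.natAbs) (by simp)
    (fun v w => (ZMod.natAbs_valMinAbs_add_le v w).trans (Int.natAbs_add_le _ _)) T c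

theorem mul_sub_le_mul_sub {x y h : ℤ} (hxy : x ≤ y) (hy : 2 * y ≤ h) :
    x * (h - x) ≤ y * (h - y) := by
  nlinarith

variable [NeZero h]

theorem two_mul_natAbs_valMinAbs_le (v : ZMod h) : 2 * v.valMinAbs.natAbs ≤ h := by
  have := ZMod.natAbs_valMinAbs_le v
  omega

theorem cyclicCut_nonneg (v : ZMod h) : 0 ≤ cyclicCut h v := by
  have := two_mul_natAbs_valMinAbs_le v
  exact mul_nonneg (by omega) (by omega)

theorem cyclicCut_natCast {x : ℕ} (hx : x ≤ h) : cyclicCut h (x : ZMod h) = x * (h - x) := by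
  unfold cyclicCut
  rw [ZMod.valMinAbs_natAbs_eq_min]
  rcases hx.eq_or_lt with rfl | hlt
  · simp
  · rw [ZMod.val_natCast_of_lt hlt]
    rcases le_total x (h - x) with hle | hle
    · rw [min_eq_left hle]
    · rw [min_eq_right hle, Nat.cast_sub hx]
      ring

theorem mul_sub_le_cyclicCut {v : ZMod h} {x : ℕ} (hx : x ≤ v.valMinAbs.natAbs) :
    (x : ℤ) * (h - x) ≤ cyclicCut h v :=
  mul_sub_le_mul_sub (by exact_mod_cast hx) (by exact_mod_cast two_mul_natAbs_valMinAbs_le v)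

theorem sub_one_le_cyclicCut {v : ZMod h} (hv : v ≠ 0) : (h : ℤ) - 1 ≤ cyclicCut h v := by
  simpa using mul_sub_le_cyclicCut (natAbs_valMinAbs_pos hv)

end CyclicCut

section CyclicIsoperimetry

variable {ι : Type*} {I : Finset ι}

theorem sub_one_mul_le_sub_card_mul_sum {T : Finset ι} {x : ι → ℕ} (hx : ∀ t ∈ T, 1 ≤ x t)
    (hT : 1 ≤ #T) {h : ℤ} (hh : 1 ≤ h) {ρ : ℕ} (hρ : ∑ t ∈ T, x t = ρ) :
    (h - 1) * (ρ * (h - ρ)) ≤ (h - #T) * ∑ t ∈ T, (x t : ℤ) * (h - x t) := by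
  classical
  have hρ' : ∑ t ∈ T, (x t : ℤ) = ρ := by exact_mod_cast hρ
  have hsplit : ∑ t ∈ T, (x t : ℤ) * (ρ - x t) =
      ∑ t ∈ T, (x t : ℤ) * (h - x t) - ρ * (h - ρ) := by
    calc ∑ t ∈ T, (x t : ℤ) * (ρ - x t)
        = ∑ t ∈ T, ((x t : ℤ) * (h - x t) - x t * (h - ρ)) := sum_congr rfl fun t _ => by ring
      _ = _ := by rw [sum_sub_distrib, ← sum_mul, hρ']
  have hupper : ∑ t ∈ T, (x t : ℤ) * (h - x t) ≤ ρ * (h - 1) := by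
    rw [← hρ', sum_mul]
    refine sum_le_sum fun t ht => ?_
    have := hx t ht
    exact mul_le_mul_of_nonneg_left (by omega) (by positivity)
  have hlower : (ρ : ℤ) * (#T - 1) ≤ ∑ t ∈ T, (x t : ℤ) * (ρ - x t) := by
    conv_lhs => rw [← hρ', sum_mul]
    refine sum_le_sum fun t ht => mul_le_mul_of_nonneg_left ?_ (by positivity)
    have hothers : #(T.erase t) ≤ ∑ s ∈ T.erase t, x s := by
      rw [card_eq_sum_ones]
      exact sum_le_sum fun s hs => hx s (mem_of_mem_erase hs)
    rw [card_erase_of_mem ht] at hothers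
    have := sum_erase_add T x ht
    omega
  have hT' : (0 : ℤ) ≤ #T - 1 := by omega
  have hchain : (#T - 1) * ∑ t ∈ T, (x t : ℤ) * (h - x t) ≤
      (h - 1) * (∑ t ∈ T, (x t : ℤ) * (h - x t) - ρ * (h - ρ)) := by
    calc (#T - 1) * ∑ t ∈ T, (x t : ℤ) * (h - x t)
        ≤ (#T - 1) * (ρ * (h - 1)) := mul_le_mul_of_nonneg_left hupper hT'
      _ = (h - 1) * (ρ * (#T - 1)) := by ring
      _ ≤ _ := hsplit ▸ mul_le_mul_of_nonneg_left hlower (by linarith)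
  linear_combination hchain

theorem sum_eq_sum_filter_sub {h : ℕ} (hI : #I = h) (c : ι → ZMod h) (v : ZMod h) :
    ∑ t ∈ I, c t = ∑ t ∈ I with c t ≠ v, (c t - v) := by
  have hconst : ∑ _ ∈ I, v = 0 := by
    rw [sum_const, hI, nsmul_eq_mul, ZMod.natCast_self, zero_mul]
  rw [← sub_zero (∑ t ∈ I, c t), ← hconst, ← sum_sub_distrib, sum_filter_of_ne]
  exact fun t _ => sub_ne_zero.1

theorem two_mul_card_mul_sum_cyclicCut_le {h : ℕ} [NeZero h] (c : ι → ZMod h) (v : ZMod h) :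
    2 * (#{t ∈ I | c t = v} * ∑ t ∈ I with c t ≠ v, cyclicCut h (c t - v)) ≤
      ∑ s ∈ I, ∑ t ∈ I, cyclicCut h (c s - c t) := by
  have hin : ∀ s ∈ I.filter (c · = v), ∑ t ∈ I with c t ≠ v, cyclicCut h (c t - v) ≤
      ∑ t ∈ I, cyclicCut h (c s - c t) := fun s hs => by
    refine (sum_le_sum_of_subset_of_nonneg (filter_subset _ _) fun t _ _ =>
      cyclicCut_nonneg _).trans_eq (sum_congr rfl fun t _ => ?_)
    rw [(mem_filter.1 hs).2, ← cyclicCut_neg, neg_sub]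
  have hout : ∀ s ∈ I.filter (c · ≠ v), #{t ∈ I | c t = v} * cyclicCut h (c s - v) ≤
      ∑ t ∈ I, cyclicCut h (c s - c t) := fun s _ => by
    rw [← nsmul_eq_mul, ← sum_const]
    refine (sum_le_sum fun t ht => ?_).trans (sum_le_sum_of_subset_of_nonneg
      (filter_subset (c · = v) I) fun t _ _ => cyclicCut_nonneg (c s - c t))
    rw [(mem_filter.1 ht).2]
  have := add_le_add (card_nsmul_le_sum _ _ _ hin) (sum_le_sum hout)
  rwa [nsmul_eq_mul, ← mul_sum, ← two_mul, sum_filter_add_sum_filter_not] at this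

theorem two_mul_sub_le_sum_card_ne {α : Type*} [DecidableEq α] (c : ι → α) {ρ : ℕ}
    (hmiss : ∀ v, ρ ≤ #{t ∈ I | c t ≠ v}) :
    2 * ((ρ : ℤ) * (#I - ρ)) ≤ ∑ s ∈ I, (#{t ∈ I | c t ≠ c s} : ℤ) := by
  have hsum : ∀ v, #{t ∈ I | c t = v} + #{t ∈ I | c t ≠ v} = #I := fun v =>
    card_filter_add_card_filter_not _
  by_cases hlarge : ∃ v, #I ≤ 2 * #{t ∈ I | c t = v}
  · obtain ⟨v, hv⟩ := hlarge
    have hin : ∀ s ∈ I.filter (c · = v), (#{t ∈ I | c t ≠ v} : ℤ) ≤ #{t ∈ I | c t ≠ c s} :=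
      fun s hs => by rw [(mem_filter.1 hs).2]
    have hout : ∀ s ∈ I.filter (c · ≠ v), (#{t ∈ I | c t = v} : ℤ) ≤ #{t ∈ I | c t ≠ c s} :=
      fun s hs => by
        refine Nat.cast_le.2 (card_le_card fun t ht => ?_)
        rw [mem_filter] at hs ht ⊢
        exact ⟨ht.1, ht.2.trans_ne hs.2.symm⟩
    have htotal := add_le_add (card_nsmul_le_sum _ _ _ hin) (card_nsmul_le_sum _ _ _ hout)
    rw [sum_filter_add_sum_filter_not] at htotal
    have hsumv := hsum v
    have hmono := mul_sub_le_mul_sub (x := ρ) (y := #{t ∈ I | c t ≠ v}) (h := #I)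
      (by exact_mod_cast hmiss v) (by omega)
    have hcard : (#I : ℤ) - #{t ∈ I | c t ≠ v} = #{t ∈ I | c t = v} := by omega
    rw [hcard] at hmono
    simp only [nsmul_eq_mul] at htotal
    linarith
  · push Not at hlarge
    have hrow : ∀ s ∈ I, (#I : ℤ) ≤ 2 * #{t ∈ I | c t ≠ c s} := fun s _ => by
      have := hlarge (c s)
      have := hsum (c s)
      omega
    have htotal := card_nsmul_le_sum _ _ _ hrow
    rw [nsmul_eq_mul, ← mul_sum] at htotal
    nlinarith [sq_nonneg ((#I : ℤ) - 2 * ρ)]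

theorem two_mul_sub_one_mul_cyclicCut_sum_le_of_forall_le {h : ℕ} [NeZero h] (hI : #I = h)
    {c : ι → ZMod h} (hmiss : ∀ v, (∑ t ∈ I, c t).valMinAbs.natAbs ≤ #{t ∈ I | c t ≠ v}) :
    2 * ((h : ℤ) - 1) * cyclicCut h (∑ t ∈ I, c t) ≤
      ∑ s ∈ I, ∑ t ∈ I, cyclicCut h (c s - c t) := by
  have hh : (1 : ℤ) ≤ h := by exact_mod_cast NeZero.one_le
  have hcount := two_mul_sub_le_sum_card_ne c hmiss
  rw [hI] at hcount
  calc 2 * ((h : ℤ) - 1) * cyclicCut h (∑ t ∈ I, c t)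
      = (h - 1) * (2 * cyclicCut h (∑ t ∈ I, c t)) := by ring
    _ ≤ (h - 1) * ∑ s ∈ I, (#{t ∈ I | c t ≠ c s} : ℤ) :=
      mul_le_mul_of_nonneg_left hcount (by linarith)
    _ ≤ ∑ s ∈ I, ∑ t ∈ I, cyclicCut h (c s - c t) := by
      rw [mul_sum]
      refine sum_le_sum fun s _ => ?_
      rw [mul_comm, ← nsmul_eq_mul, ← sum_const]
      refine (sum_le_sum fun t ht => sub_one_le_cyclicCut ?_).trans
        (sum_le_sum_of_subset_of_nonneg (filter_subset (c · ≠ c s) I)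
          fun t _ _ => cyclicCut_nonneg (c s - c t))
      exact sub_ne_zero.2 (mem_filter.1 ht).2.symm

theorem two_mul_sub_one_mul_cyclicCut_sum_le_of_lt {h : ℕ} [NeZero h] (hI : #I = h)
    {c : ι → ZMod h} {v : ZMod h} (hv : #{t ∈ I | c t ≠ v} < (∑ t ∈ I, c t).valMinAbs.natAbs) :
    2 * ((h : ℤ) - 1) * cyclicCut h (∑ t ∈ I, c t) ≤
      ∑ s ∈ I, ∑ t ∈ I, cyclicCut h (c s - c t) := by
  have hh : (1 : ℤ) ≤ h := by exact_mod_cast NeZero.one_le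
  rw [sum_eq_sum_filter_sub hI c v] at hv ⊢
  set B := {t ∈ I | c t ≠ v}
  have hpos : ∀ t ∈ B, 1 ≤ (c t - v).valMinAbs.natAbs := fun t ht =>
    natAbs_valMinAbs_pos (sub_ne_zero.2 (mem_filter.1 ht).2)
  obtain ⟨x, hx, hxsum⟩ := exists_between_sum_eq hpos (by simpa using hv.le)
    (natAbs_valMinAbs_sum_le B fun t => c t - v)
  have hne : 1 ≤ #B := by
    by_contra hcon
    have hB : B = ∅ := card_eq_zero.1 (by omega)
    simp [hB] at hv
  have hcard : (h : ℤ) - #B = #{t ∈ I | c t = v} := by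
    have : #{t ∈ I | c t = v} + #B = #I := card_filter_add_card_filter_not _
    omega
  have hconvex := sub_one_mul_le_sub_card_mul_sum (fun t ht => (hx t ht).1) hne hh hxsum
  have hle : ∑ t ∈ B, (x t : ℤ) * (h - x t) ≤ ∑ t ∈ B, cyclicCut h (c t - v) :=
    sum_le_sum fun t ht => mul_sub_le_cyclicCut (hx t ht).2
  rw [hcard] at hconvex
  calc 2 * ((h : ℤ) - 1) * cyclicCut h (∑ t ∈ B, (c t - v))
      = 2 * ((h - 1) * cyclicCut h (∑ t ∈ B, (c t - v))) := by ring
    _ ≤ 2 * (#{t ∈ I | c t = v} * ∑ t ∈ B, cyclicCut h (c t - v)) :=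
      mul_le_mul_of_nonneg_left (hconvex.trans (by gcongr)) zero_le_two
    _ ≤ _ := two_mul_card_mul_sum_cyclicCut_le c v

theorem two_mul_sub_one_mul_cyclicCut_sum_le {h : ℕ} [NeZero h] (hI : #I = h) (c : ι → ZMod h) :
    2 * ((h : ℤ) - 1) * cyclicCut h (∑ t ∈ I, c t) ≤
      ∑ s ∈ I, ∑ t ∈ I, cyclicCut h (c s - c t) := by
  by_cases hmiss : ∀ v, (∑ t ∈ I, c t).valMinAbs.natAbs ≤ #{t ∈ I | c t ≠ v}
  · exact two_mul_sub_one_mul_cyclicCut_sum_le_of_forall_le hI hmiss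
  · push Not at hmiss
    exact two_mul_sub_one_mul_cyclicCut_sum_le_of_lt hI hmiss.choose_spec

end CyclicIsoperimetry

theorem sub_one_mul_cyclicCut_le {k h : ℕ} (hh : 2 ≤ h) (hhk : 2 * h ≤ k) {K : ℚ}
    (hK : (k : ℚ) ^ 2 ≤ K * h) {x : ℕ} (hx : x ≤ k) :
    (K - 1) * cyclicCut h (x : ZMod h) ≤ (h - 1) * (x * (K - x)) := by
  have : NeZero h := ⟨by omega⟩
  have hh' : (2 : ℚ) ≤ h := by exact_mod_cast hh
  have hhk' : 2 * (h : ℚ) ≤ k := by exact_mod_cast hhk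
  have hkK : 2 * (k : ℚ) ≤ K := by
    by_contra! hcon
    nlinarith
  rcases le_total x h with hxh | hxh
  · rw [cyclicCut_natCast hxh]
    push_cast
    rcases Nat.eq_zero_or_pos x with rfl | hx0
    · simp
    · have hx0' : (1 : ℚ) ≤ x := by exact_mod_cast hx0
      have : 0 ≤ (x : ℚ) * ((K - h) * (x - 1)) :=
        mul_nonneg (by linarith) (mul_nonneg (by linarith) (by linarith))
      linear_combination this
  · have hcut : 4 * (cyclicCut h (x : ZMod h) : ℚ) ≤ (h : ℚ) ^ 2 := by
      exact_mod_cast four_mul_cyclicCut_le (x : ZMod h)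
    have hx' : (x : ℚ) ≤ k := by exact_mod_cast hx
    have hxh' : (h : ℚ) ≤ x := by exact_mod_cast hxh
    have hmono : h * (K - h) ≤ x * (K - x) := by nlinarith
    have hquad : (K - 1) * h ≤ 4 * ((h - 1) * (K - h)) := by nlinarith
    calc (K - 1) * cyclicCut h (x : ZMod h) ≤ (K - 1) * (h ^ 2 / 4) :=
          mul_le_mul_of_nonneg_left (by linarith) (by linarith)
      _ = h / 4 * ((K - 1) * h) := by ring
      _ ≤ h / 4 * (4 * ((h - 1) * (K - h))) := by gcongr
      _ = (h - 1) * (h * (K - h)) := by ring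
      _ ≤ (h - 1) * (x * (K - x)) := mul_le_mul_of_nonneg_left hmono (by linarith)

theorem two_mul_mul_sub_le_sum_abs_sub_sq {k h : ℕ} (hh : 2 ≤ h) {K : ℚ} (hK : 1 ≤ K)
    (hcut : ∀ x ≤ k, (K - 1) * cyclicCut h (x : ZMod h) ≤ (h - 1) * (x * (K - x)))
    {c : ℕ → ℕ} (hc : ∀ t, c t ≤ k) {q r : ℕ} (hr : r ≤ h)
    (hsum : ∑ t ∈ range h, c t = q * h + r) :
    2 * (K - 1) * (r * (h - r)) ≤
      ∑ s ∈ range h, ∑ t ∈ range h, (K * |(c s : ℚ) - c t| - ((c s : ℚ) - c t) ^ 2) := by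
  have : NeZero h := ⟨by omega⟩
  have hh' : (2 : ℚ) ≤ h := by exact_mod_cast hh
  have hcyclic := two_mul_sub_one_mul_cyclicCut_sum_le (card_range h) fun t => (c t : ZMod h)
  rw [← Nat.cast_sum, hsum, Nat.cast_add, Nat.cast_mul, ZMod.natCast_self, mul_zero, zero_add,
    cyclicCut_natCast hr] at hcyclic
  have hcyclic' : 2 * ((h : ℚ) - 1) * (r * (h - r)) ≤
      ∑ s ∈ range h, ∑ t ∈ range h, (cyclicCut h ((c s : ZMod h) - c t) : ℚ) := by
    exact_mod_cast hcyclic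
  have hpair (s t : ℕ) : (K - 1) * (cyclicCut h ((c s : ZMod h) - c t) : ℚ) ≤
      (h - 1) * (K * |(c s : ℚ) - c t| - ((c s : ℚ) - c t) ^ 2) := by
    wlog hle : c t ≤ c s generalizing s t
    · rw [← cyclicCut_neg, neg_sub, abs_sub_comm, sub_sq_comm]
      exact this t s (le_of_not_ge hle)
    have hle' : (c t : ℚ) ≤ c s := by exact_mod_cast hle
    have hdiff := hcut (c s - c t) ((Nat.sub_le _ _).trans (hc s))
    rw [Nat.cast_sub hle, Nat.cast_sub hle] at hdiff
    rw [abs_of_nonneg (sub_nonneg.2 hle')]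
    linear_combination hdiff
  refine le_of_mul_le_mul_left (a := (h : ℚ) - 1) ?_ (by linarith)
  calc ((h : ℚ) - 1) * (2 * (K - 1) * (r * (h - r)))
      = (K - 1) * (2 * ((h : ℚ) - 1) * (r * (h - r))) := by ring
    _ ≤ (K - 1) * ∑ s ∈ range h, ∑ t ∈ range h, (cyclicCut h ((c s : ZMod h) - c t) : ℚ) :=
        mul_le_mul_of_nonneg_left hcyclic' (by linarith)
    _ ≤ _ := by
        simp only [mul_sum]
        exact sum_le_sum fun s _ => sum_le_sum fun t _ => hpair s t

theorem sum_sum_abs_sub (c : ℕ → ℕ) (h : ℕ) :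
    ∑ s ∈ range h, ∑ t ∈ range h, |(c s : ℚ) - c t| =
      2 * (h * (∑ t ∈ range h, c t : ℕ) -
        (∑ s ∈ range h, ∑ t ∈ range h, min (c s) (c t) : ℕ)) := by
  have habs (s t : ℕ) : |(c s : ℚ) - c t| = c s + c t - 2 * (min (c s) (c t) : ℕ) := by
    rw [Nat.cast_min, ← max_sub_min_eq_abs', ← max_add_min (c s : ℚ)]
    ring
  simp only [habs, sum_sub_distrib, sum_add_distrib, sum_const, card_range, nsmul_eq_mul, ← mul_sum]
  push_cast
  ring

theorem sum_sum_sq_sub (c : ℕ → ℕ) (h : ℕ) :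
    ∑ s ∈ range h, ∑ t ∈ range h, ((c s : ℚ) - c t) ^ 2 =
      2 * (h * (∑ t ∈ range h, c t ^ 2 : ℕ) - (∑ t ∈ range h, c t : ℕ) ^ 2) := by
  simp only [sub_sq, mul_assoc, sum_sub_distrib, sum_add_distrib, sum_const, card_range,
    nsmul_eq_mul, ← mul_sum, ← sum_mul]
  push_cast
  ring

theorem cyclicCut_le_of_mul_cliqueWeight_eq {k h : ℕ} (hh : 2 ≤ h) (hhk : k = h ∨ 2 * h + 1 ≤ k)
    {K : ℚ} (hK : h * cliqueWeight h = K * cliqueWeight k) :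
    1 ≤ K ∧ ∀ x ≤ k, (K - 1) * cyclicCut h (x : ZMod h) ≤ (h - 1) * (x * (K - x)) := by
  have hh' : (2 : ℚ) ≤ h := by exact_mod_cast hh
  have hhk' : (h : ℚ) ≤ k := by exact_mod_cast (show h ≤ k by omega)
  have hdh : (0 : ℚ) < (h : ℚ) ^ 2 - 1 := by nlinarith
  have hdk : (0 : ℚ) < (k : ℚ) ^ 2 - 1 := by nlinarith
  have hK' : K * (h ^ 2 - 1) = h * (k ^ 2 - 1) := by
    rw [cliqueWeight, cliqueWeight] at hK
    field_simp at hK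
    linarith
  have hhK : (h : ℚ) ≤ K := le_of_mul_le_mul_right (hK'.symm ▸ by gcongr) hdh
  refine ⟨by linarith, fun x hx => ?_⟩
  rcases hhk with rfl | hlt
  · have : NeZero k := ⟨by omega⟩
    obtain rfl : K = k := mul_right_cancel₀ hdh.ne' hK'
    rw [cyclicCut_natCast hx]
    push_cast
    exact le_rfl
  · refine sub_one_mul_cyclicCut_le hh (by omega) (le_of_mul_le_mul_right ?_ hdh) hx
    nlinarith

theorem cliqueEnergy_pair_initialSegment_le {k h : ℕ} (hh : 2 ≤ h) (hhk : k = h ∨ 2 * h + 1 ≤ k)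
    {c : ℕ → ℕ} (hc : ∀ t, c t ≤ k) {q r : ℕ} (hq : q < k) (hr : r ≤ h)
    (hsum : ∑ t ∈ range h, c t = q * h + r) :
    cliqueEnergy [k, h] (initialSegment (q * h + r)) ≤
      cliqueWeight h * (h * (q * h + r : ℕ) -
        (∑ s ∈ range h, ∑ t ∈ range h, min (c s) (c t) : ℕ)) +
      ∑ t ∈ range h, cliqueCut k (c t) := by
  have hwk : 0 < cliqueWeight k := cliqueWeight_pos (by omega)
  obtain ⟨K, hK⟩ : ∃ K, (h : ℚ) * cliqueWeight h = K * cliqueWeight k :=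
    ⟨_, (div_mul_cancel₀ _ hwk.ne').symm⟩
  obtain ⟨hK1, hcut⟩ := cyclicCut_le_of_mul_cliqueWeight_eq hh hhk hK
  have hdiff := two_mul_mul_sub_le_sum_abs_sub_sq hh hK1 hcut hc hr hsum
  simp only [sum_sub_distrib, ← mul_sum] at hdiff
  rw [sum_sum_abs_sub, sum_sum_sq_sub, hsum] at hdiff
  have hseg := cliqueEnergy_cons_initialSegment (ks := [h]) hq (by simpa using hr)
  rw [List.prod_singleton, cliqueEnergy_singleton,
    sum_initialSegment hr] at hseg
  rw [hseg, sum_cliqueCut, hsum, cliqueCut]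
  refine le_of_mul_le_mul_left (a := (h : ℚ)) ?_ (by positivity)
  have := mul_le_mul_of_nonneg_left hdiff hwk.le
  push_cast at this ⊢
  set X : ℚ := ∑ s ∈ range h, ∑ t ∈ range h, min (c s : ℚ) (c t)
  linear_combination (1 / 2) * this + ((r : ℚ) * (h - r) - (h * (q * h + r) - X)) * hK

theorem InitialSegmentsOptimal.pair {k h : ℕ} (hh : 2 ≤ h) (hhk : k = h ∨ 2 * h + 1 ≤ k) :
    InitialSegmentsOptimal [k, h] := by
  intro f hf
  have hprod : [k, h].prod = k * h := by simp
  have hcol : ∑ y ∈ range h, ∑ a ∈ range k, f (a * h + y) = ∑ x ∈ range (k * h), f x := by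
    rw [sum_comm, sum_range_mul_eq]
  obtain ⟨q, hq, r, hr, hqr⟩ := exists_eq_mul_add (by omega : 0 < k)
    (sum_range_le_of_le_one hf (k * h))
  have hc (y : ℕ) : ∑ a ∈ range k, f (a * h + y) ≤ k := sum_range_le_of_le_one (fun a => hf _) k
  rw [hprod, hqr]
  refine (cliqueEnergy_pair_initialSegment_le hh hhk hc hq hr (hcol.trans hqr)).trans ?_
  have hrows : ∑ a ∈ range k, (∑ y ∈ range h, f (a * h + y)) ^ 2 ≤ _ :=
    (sum_sq_sum_le_sum_sq_sum_compressRows (F := fun y a => f (a * h + y))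
      (fun _ _ => hf _) h k).trans_eq (sum_sq_sum_initialSegment fun y _ => hc y)
  rw [cliqueEnergy_cons]
  simp only [cliqueEnergy_singleton, List.prod_singleton]
  rw [sum_cliqueCut h, ← sum_range_mul_eq, hqr]
  gcongr
  exact cliqueWeight_nonneg (by omega)

theorem initialSegmentsOptimal_of_pairwise {ks : List ℕ} (hks : ∀ k ∈ ks, 2 ≤ k)
    (hpair : ks.Pairwise fun k h => k = h ∨ 2 * h + 1 ≤ k) : InitialSegmentsOptimal ks := by
  induction hlen : ks.length using Nat.strong_induction_on generalizing ks with
  | _ n ih =>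
  subst hlen
  match ks with
  | [] => exact fun f _ => le_rfl
  | [h] =>
    intro f hf
    rw [cliqueEnergy_singleton, cliqueEnergy_singleton, List.prod_singleton,
      sum_initialSegment (sum_range_le_of_le_one hf _)]
  | [k, h] => exact .pair (hks h (by simp)) (by simpa using hpair)
  | k :: j :: l :: ls =>
    obtain ⟨js, h, hjs⟩ : ∃ js h, l :: ls = js ++ [h] :=
      ⟨_, _, (List.dropLast_append_getLast (List.cons_ne_nil l ls)).symm⟩
    rw [hjs, ← List.cons_append] at hks hpair ih ⊢
    have hmid : ∀ i ∈ j :: js, 2 ≤ i := fun i hi =>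
      hks i (List.mem_cons_of_mem _ (List.mem_append_left _ hi))
    have hone : ∀ i ∈ j :: js, 1 ≤ i := fun i hi => (hmid i hi).trans' one_le_two
    have hprod : 2 ≤ (j :: js).prod := by
      rw [List.prod_cons]
      exact (hmid j List.mem_cons_self).trans (Nat.le_mul_of_pos_right _ (List.one_le_prod
        fun i hi => hone i (List.mem_cons_of_mem _ hi)))
    have hh := hks h (by simp)
    have hinit : (k :: (j :: js)).Sublist (k :: (j :: js ++ [h])) :=
      (List.sublist_append_left _ _).cons_cons _
    have hhk := (List.pairwise_cons.1 hpair).1 h (by simp)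
    exact .cons_append_singleton hh (by omega) hone hprod
      (ih _ (by simp) (fun i hi => hks i (List.mem_cons_of_mem _ hi))
        (List.pairwise_cons.1 hpair).2 rfl)
      (ih _ (by simp) (fun i hi => hks i (hinit.subset hi)) (hpair.sublist hinit) rfl)

open Classical in
/-- The total variation of a function on the vertices of a graph: the sum of `|χ x - χ y|` over the
edges. Subtraction being truncated, each edge contributes in only one of its two directions, so that
for the indicator function of a set this is the size of its edge boundary. -/
noncomputable def edgeVariation {V : Type*} [Fintype V] (G : SimpleGraph V) (χ : V → ℕ) : ℕ :=
  ∑ x, ∑ y, if G.Adj x y then χ x - χ y else 0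

theorem edgeVariation_const {V : Type*} [Fintype V] (G : SimpleGraph V) (c : ℕ) :
    edgeVariation G (fun _ => c) = 0 := by
  simp [edgeVariation]

theorem edgeVariation_completeBinaryTree (k : ℕ) (g : ℕ → ℕ) :
    edgeVariation (completeBinaryTree k) (fun a => g a) =
      ∑ w ∈ range k, ((g ((w - 1) / 2) - g w) + (g w - g ((w - 1) / 2))) := by
  classical
  have hedge (x y : Fin k) : (if (completeBinaryTree k).Adj x y then g x - g y else 0) =
      (if x.val = (y - 1) / 2 then g x - g y else 0) +
        if y.val = (x - 1) / 2 then g x - g y else 0 := by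
    have hadj : (completeBinaryTree k).Adj x y ↔
        (x.val = (y - 1) / 2 ∧ y.val ≠ 0) ∨ (y.val = (x - 1) / 2 ∧ x.val ≠ 0) := by
      simp only [completeBinaryTree]
      omega
    rcases eq_or_ne x y with rfl | hxy
    · simp
    · have := Fin.val_ne_of_ne hxy
      simp only [hadj]
      split_ifs <;> omega
  have hparent (w : Fin k) (F : ℕ → ℕ) :
      ∑ x : Fin k, (if x.val = (w - 1) / 2 then F x else 0) = F ((w - 1) / 2) := by
    rw [sum_eq_single_of_mem ⟨(w - 1) / 2, by omega⟩ (mem_univ _), if_pos rfl]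
    exact fun x _ hx => if_neg fun h => hx (Fin.ext h)
  simp only [edgeVariation, hedge, sum_add_distrib]
  rw [sum_comm, ← Fin.sum_univ_eq_sum_range (fun w => g ((w - 1) / 2) - g w),
    ← Fin.sum_univ_eq_sum_range (fun w => g w - g ((w - 1) / 2))]
  exact congr_arg₂ _ (sum_congr rfl fun y _ => hparent y (g · - g y))
    (sum_congr rfl fun x _ => hparent x (g x - g ·))

theorem cast_edgeVariation_completeBinaryTree (k : ℕ) (g : ℕ → ℕ) :
    (edgeVariation (completeBinaryTree k) (fun a => g a) : ℚ) =
      ∑ w ∈ range k, |(g w : ℚ) - g ((w - 1) / 2)| := by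
  rw [edgeVariation_completeBinaryTree, Nat.cast_sum]
  refine sum_congr rfl fun w _ => ?_
  rcases le_total (g w) (g ((w - 1) / 2)) with h | h
  · rw [Nat.sub_eq_zero_of_le h, add_zero, Nat.cast_sub h, abs_sub_comm,
      abs_of_nonneg (sub_nonneg.2 (Nat.cast_le.2 h))]
  · rw [Nat.sub_eq_zero_of_le h, zero_add, Nat.cast_sub h,
      abs_of_nonneg (sub_nonneg.2 (Nat.cast_le.2 h))]

/-- In the binary tree on `ℕ` in which the parent of `w ≠ 0` is `(w - 1) / 2`, the function
`subtree w` is the indicator function of the set of descendants of `w`, including `w` itself.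
For the root it is `0` by convention. -/
def subtree (w : ℕ) : ℕ → ℕ
  | 0 => 0
  | u + 1 => if w = u + 1 then 1 else subtree w (u / 2)
termination_by u => u
decreasing_by omega

theorem subtree_zero (w : ℕ) : subtree w 0 = 0 := by rw [subtree]

theorem subtree_succ (w u : ℕ) :
    subtree w (u + 1) = if w = u + 1 then 1 else subtree w (u / 2) := by rw [subtree]

theorem subtree_le_one (w u : ℕ) : subtree w u ≤ 1 := by
  fun_induction subtree w u with
  | case1 => exact Nat.zero_le 1
  | case2 => exact le_rfl
  | case3 _ _ ih => exact ih

theorem subtree_eq_zero_of_lt {w u : ℕ} (h : u < w) : subtree w u = 0 := by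
  fun_induction subtree w u with
  | case1 => rfl
  | case2 => omega
  | case3 _ _ ih => exact ih (by omega)

theorem sub_root_eq_sum_subtree {R : Type*} [Ring R] (g : ℕ → R) {k u : ℕ} (hu : u < k) :
    g u - g 0 = ∑ w ∈ range k, (subtree w u : R) * (g w - g ((w - 1) / 2)) := by
  induction u using Nat.strong_induction_on with
  | _ u ih =>
    rcases u with _ | u
    · simp [subtree_zero]
    · have hstep (w : ℕ) : (subtree w (u + 1) : R) * (g w - g ((w - 1) / 2)) =
          subtree w (u / 2) * (g w - g ((w - 1) / 2)) +
            if w = u + 1 then g (u + 1) - g (u / 2) else 0 := by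
        rw [subtree_succ]
        split_ifs with h
        · subst h
          simp [subtree_eq_zero_of_lt (show u / 2 < u + 1 by omega)]
        · simp
      simp only [hstep, sum_add_distrib]
      rw [← ih (u / 2) (by omega) (by omega), sum_ite_eq' (range k), if_pos (mem_range.2 hu)]
      abel

theorem sum_sum_abs_sub_of_le_one {x : ℕ → ℕ} (hx : ∀ u, x u ≤ 1) (k : ℕ) :
    ∑ u ∈ range k, ∑ v ∈ range k, |(x u : ℚ) - x v| =
      2 * ((∑ u ∈ range k, x u : ℕ) * (k - (∑ u ∈ range k, x u : ℕ))) := by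
  have habs (u v : ℕ) : |(x u : ℚ) - x v| = ((x u : ℚ) - x v) ^ 2 := by
    have hu := hx u
    have hv := hx v
    interval_cases x u <;> interval_cases x v <;> norm_num
  have hsq (u : ℕ) : x u ^ 2 = x u := by
    have hu := hx u
    interval_cases x u <;> rfl
  simp only [habs, sum_sum_sq_sub, hsq]
  ring

theorem two_mul_sum_abs_subtree_sub_le {k : ℕ} (hk : Odd k) (w : ℕ) :
    2 * ∑ u ∈ range k, ∑ v ∈ range k, |(subtree w u : ℚ) - subtree w v| ≤ (k : ℚ) ^ 2 - 1 := by
  rw [sum_sum_abs_sub_of_le_one (subtree_le_one w)]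
  generalize ∑ u ∈ range k, subtree w u = s
  obtain ⟨j, rfl⟩ := hk
  have hsep : 0 ≤ ((j : ℚ) - s) * (j + 1 - s) := by
    rcases Nat.lt_or_ge j s with h | h
    · have : (j : ℚ) + 1 ≤ s := by exact_mod_cast h
      exact mul_nonneg_of_nonpos_of_nonpos (by linarith) (by linarith)
    · have : (s : ℚ) ≤ j := by exact_mod_cast h
      exact mul_nonneg (by linarith) (by linarith)
  push_cast
  linear_combination 4 * hsep

theorem two_mul_sum_sum_abs_sub_le {k : ℕ} (hk : Odd k) (g : ℕ → ℚ) :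
    2 * ∑ u ∈ range k, ∑ v ∈ range k, |g u - g v| ≤
      ((k : ℚ) ^ 2 - 1) * ∑ w ∈ range k, |g w - g ((w - 1) / 2)| := by
  have hpath : ∀ u ∈ range k, ∀ v ∈ range k, |g u - g v| ≤
      ∑ w ∈ range k, |(subtree w u : ℚ) - subtree w v| * |g w - g ((w - 1) / 2)| := by
    intro u hu v hv
    rw [← sub_sub_sub_cancel_right (g u) (g v) (g 0), sub_root_eq_sum_subtree g (mem_range.1 hu),
      sub_root_eq_sum_subtree g (mem_range.1 hv), ← sum_sub_distrib]
    simp only [← sub_mul, ← abs_mul]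
    exact abs_sum_le_sum_abs _ _
  calc 2 * ∑ u ∈ range k, ∑ v ∈ range k, |g u - g v|
      ≤ 2 * ∑ u ∈ range k, ∑ v ∈ range k, ∑ w ∈ range k,
          |(subtree w u : ℚ) - subtree w v| * |g w - g ((w - 1) / 2)| :=
        mul_le_mul_of_nonneg_left
          (sum_le_sum fun u hu => sum_le_sum fun v hv => hpath u hu v hv) zero_le_two
    _ = ∑ w ∈ range k, (2 * ∑ u ∈ range k, ∑ v ∈ range k, |(subtree w u : ℚ) - subtree w v|) *
          |g w - g ((w - 1) / 2)| := by
        simp only [mul_sum, sum_mul, mul_assoc]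
        rw [sum_congr rfl fun u _ => sum_comm, sum_comm]
    _ ≤ ((k : ℚ) ^ 2 - 1) * ∑ w ∈ range k, |g w - g ((w - 1) / 2)| := by
        rw [mul_sum]
        exact sum_le_sum fun w _ =>
          mul_le_mul_of_nonneg_right (two_mul_sum_abs_subtree_sub_le hk w) (abs_nonneg _)

theorem cliqueCut_le_edgeVariation {k : ℕ} (hk : 2 ≤ k) (hodd : Odd k) {g : ℕ → ℕ}
    (hg : ∀ u, g u ≤ 1) :
    cliqueCut k (∑ u ∈ range k, g u : ℕ) ≤
      edgeVariation (completeBinaryTree k) (fun a => g a) := by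
  have hk' : (2 : ℚ) ≤ k := by exact_mod_cast hk
  have hpoincare := two_mul_sum_sum_abs_sub_le hodd fun u => (g u : ℚ)
  rw [sum_sum_abs_sub_of_le_one hg, ← cast_edgeVariation_completeBinaryTree] at hpoincare
  rw [cliqueCut, cliqueWeight, div_mul_eq_mul_div, div_le_iff₀ (by nlinarith)]
  linarith

/-- The number of edges of the product of the complete binary trees whose orders are listed that
leave the set with indicator function `f`, the vertices being numbered lexicographically. -/
noncomputable def treeEnergy (ks : List ℕ) (f : ℕ → ℕ) : ℕ :=
  productEnergy (fun k g => edgeVariation (completeBinaryTree k) fun a => g a) ks f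

theorem cliqueEnergy_le_treeEnergy {ks : List ℕ} (hks : ∀ k ∈ ks, 2 ≤ k ∧ Odd k) {f : ℕ → ℕ}
    (hf : ∀ x, f x ≤ 1) : cliqueEnergy ks f ≤ treeEnergy ks f := by
  rw [treeEnergy, ← Nat.coe_castAddMonoidHom, map_productEnergy]
  exact productEnergy_mono
    (fun k hk g hg => cliqueCut_le_edgeVariation (hks k hk).1 (hks k hk).2 hg) hf

theorem Psi_succ {d : ℕ} (k : Fin (d + 1) → ℕ) :
    Psi k (d + 1) = (List.ofFn fun i => k (Fin.succ i)).prod + Psi (fun i => k (Fin.succ i)) d := by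
  have hPsi {d : ℕ} (k : Fin d → ℕ) : Psi k d = ∑ i, ∏ j with i < j, k j := by simp [Psi]
  rw [hPsi, hPsi, Fin.sum_univ_succ]
  simp only [prod_filter, Fin.prod_univ_succ, List.prod_ofFn, Fin.succ_pos, Fin.succ_lt_succ_iff,
    Fin.not_lt_zero, lt_irrefl, if_true, if_false, one_mul]

theorem odd_list_prod {ks : List ℕ} (hks : ∀ k ∈ ks, Odd k) : Odd ks.prod :=
  List.prod_induction Odd (fun _ _ => Odd.mul) odd_one hks

theorem mul_div_two_of_odd {k n : ℕ} (hk : Odd k) (hn : Odd n) :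
    k * n / 2 = k / 2 * n + n / 2 := by
  obtain ⟨i, rfl⟩ := hk
  obtain ⟨j, rfl⟩ := hn
  have hprod : (2 * i + 1) * (2 * j + 1) = 2 * (i * (2 * j + 1) + j) + 1 := by ring
  have hi : (2 * i + 1) / 2 = i := by omega
  have hj : (2 * j + 1) / 2 = j := by omega
  rw [hprod, hi, hj]
  omega

theorem cliqueCut_half {k : ℕ} (hk : 2 ≤ k) (hodd : Odd k) : cliqueCut k (k / 2 : ℕ) = 1 := by
  obtain ⟨i, rfl⟩ := hodd
  have hi : (i : ℚ) ≠ 0 := by norm_cast; omega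
  have hden : (2 * (i : ℚ) + 1) ^ 2 - 1 ≠ 0 := by
    rw [show (2 * (i : ℚ) + 1) ^ 2 - 1 = 4 * (i * (i + 1)) by ring]
    positivity
  rw [show (2 * i + 1) / 2 = i by omega, cliqueCut, cliqueWeight]
  push_cast
  field_simp
  ring

theorem cliqueEnergy_initialSegment_half {d : ℕ} {k : Fin d → ℕ} (hk : ∀ i, 2 ≤ k i)
    (hodd : ∀ i, Odd (k i)) :
    cliqueEnergy (List.ofFn k) (initialSegment ((List.ofFn k).prod / 2)) = Psi k d := by
  induction d with
  | zero => simp [cliqueEnergy, productEnergy, Psi]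
  | succ d ih =>
    have hprod : Odd (List.ofFn fun i => k (Fin.succ i)).prod :=
      odd_list_prod (List.forall_mem_ofFn_iff.2 fun i => hodd i.succ)
    have hmid : (k 0 : ℚ) - 2 * (k 0 / 2 : ℕ) - 1 = 0 := by
      have : (2 * (k 0 / 2 : ℕ) + 1 : ℚ) = k 0 := by
        exact_mod_cast Nat.two_mul_div_two_add_one_of_odd (hodd 0)
      linarith
    have hcut := cliqueCut_half (hk 0) (hodd 0)
    rw [cliqueCut] at hcut
    rw [List.ofFn_succ, List.prod_cons, mul_div_two_of_odd (hodd 0) hprod,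
      cliqueEnergy_cons_initialSegment (Nat.div_lt_self (hodd 0).pos one_lt_two)
        (Nat.div_le_self _ _), ih (fun i => hk i.succ) (fun i => hodd i.succ), Psi_succ,
      Nat.cast_add]
    linear_combination ((List.ofFn fun i => k (Fin.succ i)).prod : ℚ) * hcut +
      cliqueWeight (k 0) * ((List.ofFn fun i => k (Fin.succ i)).prod / 2 : ℕ) * hmid

theorem Psi_le_treeEnergy {d : ℕ} {k : Fin d → ℕ} (hk : ∀ i, 2 ≤ k i) (hodd : ∀ i, Odd (k i))
    (hpair : (List.ofFn k).Pairwise fun a b => a = b ∨ 2 * b + 1 ≤ a) {f : ℕ → ℕ}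
    (hf : ∀ x, f x ≤ 1) (hsum : ∑ x ∈ range (List.ofFn k).prod, f x = (List.ofFn k).prod / 2) :
    Psi k d ≤ treeEnergy (List.ofFn k) f := by
  rw [← Nat.cast_le (α := ℚ)]
  calc (Psi k d : ℚ)
      = cliqueEnergy (List.ofFn k) (initialSegment (∑ x ∈ range (List.ofFn k).prod, f x)) := by
        rw [hsum, cliqueEnergy_initialSegment_half hk hodd]
    _ ≤ cliqueEnergy (List.ofFn k) f :=
        initialSegmentsOptimal_of_pairwise (List.forall_mem_ofFn_iff.2 hk) hpair f hf
    _ ≤ treeEnergy (List.ofFn k) f :=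
        cliqueEnergy_le_treeEnergy (List.forall_mem_ofFn_iff.2 fun i => ⟨hk i, hodd i⟩) hf

theorem sum_range_two_mul_add_three_subtree_one (n : ℕ) :
    ∑ u ∈ range (2 * n + 3), subtree 1 u = 2 * ∑ u ∈ range (n + 1), subtree 1 u + 1 := by
  induction n with
  | zero => simp [sum_range_succ, subtree_zero, subtree_succ]
  | succ n ih =>
    rw [show 2 * (n + 1) + 3 = 2 * n + 3 + 1 + 1 by ring, sum_range_succ, sum_range_succ, ih,
      sum_range_succ _ (n + 1), subtree_succ, if_neg (by omega), subtree_succ, if_neg (by omega),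
      show (2 * n + 3) / 2 = n + 1 by omega, show (2 * n + 2) / 2 = n + 1 by omega]
    ring

theorem sum_subtree_one (l : ℕ) : ∑ u ∈ range (2 ^ (l + 1) - 1), subtree 1 u = 2 ^ l - 1 := by
  induction l with
  | zero => simp [subtree_zero]
  | succ l ih =>
    have hpos : 0 < 2 ^ l := Nat.two_pow_pos l
    obtain ⟨n, hn⟩ : ∃ n, 2 ^ (l + 1) = n + 2 := ⟨2 * (2 ^ l - 1), by rw [pow_succ]; omega⟩
    rw [hn, show n + 2 - 1 = n + 1 by omega] at ih
    rw [pow_succ, hn, show (n + 2) * 2 - 1 = 2 * n + 3 by omega,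
      sum_range_two_mul_add_three_subtree_one, ih]
    rw [pow_succ] at hn
    omega

theorem sum_subtree_one_eq_half {l : ℕ} (hl : l ≠ 0) :
    ∑ u ∈ range (2 ^ l - 1), subtree 1 u = (2 ^ l - 1) / 2 := by
  obtain ⟨l, rfl⟩ := Nat.exists_eq_succ_of_ne_zero hl
  rw [sum_subtree_one, pow_succ]
  omega

/-- The indicator function of a bisection of the product of the complete binary trees whose orders
are listed: in the first factor, the slices over the left subtree of the root are taken entirely,
those over the right subtree not at all, and the slice over the root is bisected in turn. -/
def bisectingSet : List ℕ → ℕ → ℕ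
  | [], _ => 0
  | _ :: ks, x => if x < ks.prod then bisectingSet ks x else subtree 1 (x / ks.prod)

theorem bisectingSet_le_one (ks : List ℕ) (x : ℕ) : bisectingSet ks x ≤ 1 := by
  fun_induction bisectingSet ks x with
  | case1 => exact Nat.zero_le 1
  | case2 _ _ _ _ ih => exact ih
  | case3 => exact subtree_le_one _ _

theorem bisectingSet_cons_of_lt {k y : ℕ} {ks : List ℕ} (hy : y < ks.prod) :
    bisectingSet (k :: ks) (0 * ks.prod + y) = bisectingSet ks y := by
  rw [zero_mul, zero_add, bisectingSet, if_pos hy]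

theorem bisectingSet_cons_of_ne_zero {k a y : ℕ} {ks : List ℕ} (ha : a ≠ 0) (hy : y < ks.prod) :
    bisectingSet (k :: ks) (a * ks.prod + y) = subtree 1 a := by
  have hle : ks.prod ≤ a * ks.prod := Nat.le_mul_of_pos_left _ (Nat.pos_of_ne_zero ha)
  rw [bisectingSet, if_neg (by omega), index_div hy]

theorem sum_bisectingSet {ks : List ℕ} (hodd : ∀ k ∈ ks, Odd k)
    (hhalf : ∀ k ∈ ks, ∑ a ∈ range k, subtree 1 a = k / 2) :
    ∑ x ∈ range ks.prod, bisectingSet ks x = ks.prod / 2 := by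
  induction ks with
  | nil => simp [bisectingSet]
  | cons k ks ih =>
    rw [List.forall_mem_cons] at hodd hhalf
    obtain ⟨n, rfl⟩ := Nat.exists_eq_add_of_lt hodd.1.pos
    have hslices := hhalf.1
    rw [sum_range_succ', subtree_zero, add_zero] at hslices
    rw [List.prod_cons, sum_range_mul_eq, mul_div_two_of_odd hodd.1 (odd_list_prod hodd.2),
      ← hslices, sum_range_succ', sum_mul, ← ih hodd.2 hhalf.2]
    congr 1
    · refine sum_congr rfl fun a _ => ?_
      rw [sum_congr rfl fun y hy => bisectingSet_cons_of_ne_zero a.succ_ne_zero (mem_range.1 hy),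
        sum_const, card_range, smul_eq_mul, mul_comm]
    · exact sum_congr rfl fun y hy => bisectingSet_cons_of_lt (mem_range.1 hy)

theorem edgeVariation_congr_of_lt {k : ℕ} {g g' : ℕ → ℕ} (h : ∀ a < k, g a = g' a)
    (G : SimpleGraph (Fin k)) :
    edgeVariation G (fun a => g a) = edgeVariation G fun a => g' a :=
  congr_arg (edgeVariation G) (funext fun a => h a a.isLt)

theorem treeEnergy_congr {ks : List ℕ} {f f' : ℕ → ℕ} (h : ∀ x < ks.prod, f x = f' x) :
    treeEnergy ks f = treeEnergy ks f' :=
  productEnergy_congr (fun _ _ _ hg => edgeVariation_congr_of_lt hg _) h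

theorem treeEnergy_const (ks : List ℕ) (c : ℕ) : treeEnergy ks (fun _ => c) = 0 :=
  productEnergy_const (fun k => edgeVariation_const (completeBinaryTree k) c) ks

theorem edgeVariation_completeBinaryTree_eq_one {k : ℕ} (hk : 3 ≤ k) {g : ℕ → ℕ} (h0 : g 0 ≤ 1)
    (hg : ∀ a ≠ 0, g a = subtree 1 a) :
    edgeVariation (completeBinaryTree k) (fun a => g a) = 1 := by
  obtain ⟨j, rfl⟩ := Nat.exists_eq_add_of_le hk
  have h1 : g 1 = 1 := by rw [hg 1 one_ne_zero, subtree_succ, if_pos rfl]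
  have h2 : g 2 = 0 := by
    rw [hg 2 two_ne_zero, subtree_succ, if_neg (by omega), Nat.div_eq_of_lt one_lt_two,
      subtree_zero]
  have hdeep (w : ℕ) : g (3 + w) = g ((3 + w - 1) / 2) := by
    rw [hg _ (by omega), hg _ (by omega), show 3 + w = w + 2 + 1 by ring, subtree_succ,
      if_neg (by omega), Nat.add_sub_cancel]
  rw [edgeVariation_completeBinaryTree, sum_range_add]
  simp only [hdeep, sum_range_succ, sum_range_zero, Nat.sub_self]
  norm_num [h1, h2]
  omega

theorem treeEnergy_bisectingSet {d : ℕ} {k : Fin d → ℕ} (hk : ∀ i, 3 ≤ k i) :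
    treeEnergy (List.ofFn k) (bisectingSet (List.ofFn k)) = Psi k d := by
  induction d with
  | zero => simp [treeEnergy, productEnergy, Psi]
  | succ d ih =>
    rw [List.ofFn_succ, Psi_succ, ← ih fun i => hk i.succ]
    set ks := List.ofFn fun i => k (Fin.succ i)
    have hcolumn : ∀ y ∈ range ks.prod, edgeVariation (completeBinaryTree (k 0))
        (fun a => bisectingSet (k 0 :: ks) (a * ks.prod + y)) = 1 := fun y hy =>
      edgeVariation_completeBinaryTree_eq_one
        (g := fun a => bisectingSet (k 0 :: ks) (a * ks.prod + y)) (hk 0)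
        (bisectingSet_le_one _ _) fun a ha => bisectingSet_cons_of_ne_zero ha (mem_range.1 hy)
    have hslices : ∑ a ∈ range (k 0),
        treeEnergy ks (fun y => bisectingSet (k 0 :: ks) (a * ks.prod + y)) =
          treeEnergy ks (bisectingSet ks) := by
      rw [sum_eq_single_of_mem 0 (mem_range.2 (by have := hk 0; omega)),
        treeEnergy_congr fun y hy => bisectingSet_cons_of_lt hy]
      intro a _ ha
      rw [treeEnergy_congr fun y hy => bisectingSet_cons_of_ne_zero ha hy, treeEnergy_const]
    calc treeEnergy (k 0 :: ks) (bisectingSet (k 0 :: ks))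
        = _ + ∑ _ ∈ range ks.prod, 1 := congr_arg₂ _ hslices (sum_congr rfl hcolumn)
      _ = ks.prod + treeEnergy ks (bisectingSet ks) := by
        rw [sum_const, card_range, smul_eq_mul, mul_one, add_comm]

section CartesianProduct

variable {d : ℕ} {V : Fin (d + 1) → Type*} (G : ∀ i, SimpleGraph (V i))

theorem cartesianProduct_adj_cons (a b : V 0) (x y : ∀ i : Fin d, V i.succ) :
    (cartesianProduct G).Adj (Fin.cons a x) (Fin.cons b y) ↔
      (a = b ∧ (cartesianProduct fun i => G (Fin.succ i)).Adj x y) ∨ (x = y ∧ (G 0).Adj a b) := by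
  simp only [cartesianProduct, Fin.exists_fin_succ, Fin.forall_fin_succ, Fin.cons_zero,
    Fin.cons_succ, Fin.succ_inj, ne_eq, not_true_eq_false, false_imp_iff, true_and,
    Fin.succ_ne_zero, (Fin.succ_ne_zero _).symm, not_false_eq_true, true_imp_iff, funext_iff,
    and_left_comm (b := a = b), exists_and_left, and_comm (b := (G 0).Adj a b)]
  exact or_comm

theorem edgeVariation_cartesianProduct_succ [∀ i, Fintype (V i)] (χ : (∀ i, V i) → ℕ) :
    edgeVariation (cartesianProduct G) χ =
      ∑ a, edgeVariation (cartesianProduct fun i => G (Fin.succ i)) (fun y => χ (Fin.cons a y)) +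
        ∑ y, edgeVariation (G 0) fun a => χ (Fin.cons a y) := by
  classical
  have hreindex (F : (∀ i, V i) → ℕ) :
      ∑ x, F x = ∑ a, ∑ y : ∀ i : Fin d, V i.succ, F (Fin.cons a y) := by
    rw [← Fintype.sum_prod_type']
    exact (Fintype.sum_equiv (Fin.consEquiv V) _ _ fun _ => rfl).symm
  have hsplit (a b : V 0) (x y : ∀ i : Fin d, V i.succ) :
      (if (cartesianProduct G).Adj (Fin.cons a x) (Fin.cons b y)
        then χ (Fin.cons a x) - χ (Fin.cons b y) else 0) =
      (if a = b then if (cartesianProduct fun i => G (Fin.succ i)).Adj x y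
        then χ (Fin.cons a x) - χ (Fin.cons b y) else 0 else 0) +
      if x = y then if (G 0).Adj a b then χ (Fin.cons a x) - χ (Fin.cons b y) else 0 else 0 := by
    simp only [cartesianProduct_adj_cons]
    rcases eq_or_ne a b with rfl | hab
    · simp
    · simp [hab, ite_and]
  simp only [edgeVariation, hreindex, hsplit, sum_add_distrib, sum_ite_eq, mem_univ, if_true]
  congr 1
  · refine sum_congr rfl fun a _ => sum_congr rfl fun x _ => ?_
    rw [sum_comm]
    simp only [sum_ite_eq, mem_univ, if_true]
  · exact sum_comm

end CartesianProduct

/-- The position of a vertex in the lexicographic order, the first coordinate being the most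
significant one. -/
def lexEquiv : {d : ℕ} → (k : Fin d → ℕ) → (∀ i, Fin (k i)) ≃ Fin (List.ofFn k).prod
  | 0, _ => Equiv.ofUnique _ (Fin 1)
  | _ + 1, k => (Fin.consEquiv fun i => Fin (k i)).symm.trans <|
      ((Equiv.refl _).prodCongr (lexEquiv fun i => k (Fin.succ i))).trans <|
        finProdFinEquiv.trans <| finCongr <| by rw [List.ofFn_succ, List.prod_cons]

theorem lexEquiv_cons {d : ℕ} (k : Fin (d + 1) → ℕ) (a : Fin (k 0))
    (y : ∀ i : Fin d, Fin (k i.succ)) :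
    (lexEquiv k (Fin.cons a y) : ℕ) =
      a * (List.ofFn fun i => k (Fin.succ i)).prod + lexEquiv (fun i => k (Fin.succ i)) y := by
  rw [Nat.add_comm (_ * _), Nat.mul_comm]
  rfl

theorem edgeVariation_meshConnectedTrees {d : ℕ} (k : Fin d → ℕ) (f : ℕ → ℕ) :
    edgeVariation (meshConnectedTrees k) (fun x => f (lexEquiv k x)) =
      treeEnergy (List.ofFn k) f := by
  induction d generalizing f with
  | zero => simp [edgeVariation, meshConnectedTrees, cartesianProduct, treeEnergy, productEnergy]
  | succ d ih =>
    set ks := List.ofFn fun i => k (Fin.succ i)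
    calc edgeVariation (meshConnectedTrees k) (fun x => f (lexEquiv k x))
        = ∑ a, edgeVariation (meshConnectedTrees fun i => k (Fin.succ i))
              (fun y => f (lexEquiv k (Fin.cons a y))) +
            ∑ y, edgeVariation (completeBinaryTree (k 0))
              (fun a => f (lexEquiv k (Fin.cons a y))) :=
          edgeVariation_cartesianProduct_succ _ _
      _ = ∑ a : Fin (k 0), treeEnergy ks (fun y => f (a * ks.prod + y)) +
            ∑ y : Fin ks.prod, edgeVariation (completeBinaryTree (k 0))
              (fun a => f (a * ks.prod + y)) := by
          simp only [lexEquiv_cons]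
          exact congr_arg₂ _ (sum_congr rfl fun a _ => ih _ fun y => f (a * ks.prod + y))
            (Equiv.sum_comp (lexEquiv _) fun y : Fin ks.prod =>
              edgeVariation (completeBinaryTree (k 0)) fun a => f (a * ks.prod + y))
      _ = treeEnergy (List.ofFn k) f := by
          rw [Fin.sum_univ_eq_sum_range fun a => treeEnergy ks fun y => f (a * ks.prod + y),
            Fin.sum_univ_eq_sum_range fun y => edgeVariation (completeBinaryTree (k 0))
              fun a => f (a * ks.prod + y), List.ofFn_succ]
          rfl

section Bisection

variable {V : Type*} [Fintype V] (G : SimpleGraph V)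

theorem ncard_edgeBoundary [DecidableEq V] (S : Finset V) :
    (edgeBoundary G S).ncard = edgeVariation G fun x => if x ∈ S then 1 else 0 := by
  classical
  set T : Finset (V × V) := {p | G.Adj p.1 p.2 ∧ p.1 ∈ S ∧ p.2 ∉ S} with hT
  have himage : edgeBoundary G S = (fun p : V × V => s(p.1, p.2)) '' T := by
    ext e
    simp only [edgeBoundary, hT, coe_filter, mem_univ, true_and, Set.mem_image, Prod.exists]
    constructor
    · rintro ⟨he, u, hu, v, hv, rfl⟩
      exact ⟨u, v, ⟨he, hu, hv⟩, rfl⟩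
    · rintro ⟨u, v, ⟨huv, hu, hv⟩, rfl⟩
      exact ⟨huv, u, hu, v, hv, rfl⟩
  have hinj : Set.InjOn (fun p : V × V => s(p.1, p.2)) T := by
    rintro ⟨u, v⟩ hp ⟨u', v'⟩ hp' heq
    simp only [hT, coe_filter, mem_univ, true_and, Set.mem_ofPred_eq] at hp hp'
    rcases Sym2.eq_iff.1 heq with ⟨rfl, rfl⟩ | ⟨rfl, rfl⟩
    · rfl
    · exact absurd hp.2.1 hp'.2.2
  rw [himage, hinj.ncard_image, Set.ncard_coe_finset, hT, card_filter, edgeVariation,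
    Fintype.sum_prod_type]
  refine sum_congr rfl fun x _ => sum_congr rfl fun y _ => ?_
  by_cases hx : x ∈ S <;> by_cases hy : y ∈ S <;> simp [hx, hy]

theorem mem_bisectionSizes_iff {n : ℕ} (e : V ≃ Fin n) (m : ℕ) :
    m ∈ bisectionSizes G ↔ ∃ f : ℕ → ℕ, (∀ x, f x ≤ 1) ∧ ∑ x ∈ range n, f x = n / 2 ∧
      edgeVariation G (fun v => f (e v)) = m := by
  classical
  have hsum (f : ℕ → ℕ) : ∑ x ∈ range n, f x = ∑ v, f (e v) := by
    rw [← Fin.sum_univ_eq_sum_range, ← e.sum_comp]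
  simp only [bisectionSizes, Set.mem_ofPred_eq, ncard_edgeBoundary, hsum, Fintype.card_congr e,
    Fintype.card_fin]
  constructor
  · rintro ⟨S, hS, hm⟩
    refine ⟨fun x => if ∃ v ∈ S, e v = x then 1 else 0, fun x => ?_, ?_, ?_⟩
    · dsimp only
      split_ifs <;> simp
    · simpa [Fin.val_inj] using hS
    · simpa [Fin.val_inj] using hm
  · rintro ⟨f, hf, hs, hm⟩
    have hind (v : V) : (if f (e v) = 1 then 1 else 0) = f (e v) := by
      have := hf (e v)
      split_ifs <;> omega
    refine ⟨({v | f (e v) = 1} : Finset V), ?_, ?_⟩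
    · rw [card_filter, ← hs]
      exact sum_congr rfl fun v _ => hind v
    · simpa only [mem_filter, mem_univ, true_and, hind] using hm

end Bisection

theorem three_le_two_pow_sub_one {l : ℕ} (hl : 2 ≤ l) : 3 ≤ 2 ^ l - 1 :=
  Nat.sub_le_sub_right (Nat.pow_le_pow_right two_pos hl) 1

theorem odd_two_pow_sub_one {l : ℕ} (hl : l ≠ 0) : Odd (2 ^ l - 1) :=
  Nat.Even.sub_odd Nat.one_le_two_pow (even_two.pow_of_ne_zero hl) odd_one

theorem eq_or_two_mul_add_one_le_of_two_pow_sub_one {m n : ℕ} (hle : 2 ^ m - 1 ≤ 2 ^ n - 1) :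
    2 ^ n - 1 = 2 ^ m - 1 ∨ 2 * (2 ^ m - 1) + 1 ≤ 2 ^ n - 1 := by
  have hm : 0 < 2 ^ m := Nat.two_pow_pos m
  have hn : 0 < 2 ^ n := Nat.two_pow_pos n
  have hmn : m ≤ n := (Nat.pow_le_pow_iff_right one_lt_two).1 (by omega)
  rcases hmn.eq_or_lt with rfl | hlt
  · exact Or.inl rfl
  · have hpow : 2 ^ (m + 1) ≤ 2 ^ n := Nat.pow_le_pow_right two_pos hlt
    rw [pow_succ] at hpow
    omega

theorem mainTheorem3 (d : ℕ) (k : Fin d → ℕ)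
    (hk : ∀ i, ∃ l : ℕ, 2 ≤ l ∧ k i = 2 ^ l - 1) (hanti : Antitone k) :
    bisectionWidth (meshConnectedTrees k) = Psi k d := by
  choose l hl hkl using hk
  have hl' (i : Fin d) : l i ≠ 0 := (two_pos.trans_le (hl i)).ne'
  have hthree (i : Fin d) : 3 ≤ k i := hkl i ▸ three_le_two_pow_sub_one (hl i)
  have hodd (i : Fin d) : Odd (k i) := hkl i ▸ odd_two_pow_sub_one (hl' i)
  have hhalf (i : Fin d) : ∑ a ∈ range (k i), subtree 1 a = k i / 2 :=
    hkl i ▸ sum_subtree_one_eq_half (hl' i)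
  have hpair : (List.ofFn k).Pairwise fun a b => a = b ∨ 2 * b + 1 ≤ a :=
    List.pairwise_ofFn.2 fun i j hij => hkl i ▸ hkl j ▸
      eq_or_two_mul_add_one_le_of_two_pow_sub_one (hkl i ▸ hkl j ▸ hanti hij.le)
  have hsizes (m : ℕ) := mem_bisectionSizes_iff (meshConnectedTrees k) (lexEquiv k) m
  simp only [edgeVariation_meshConnectedTrees] at hsizes
  have hupper : Psi k d ∈ bisectionSizes (meshConnectedTrees k) :=
    (hsizes _).2 ⟨bisectingSet (List.ofFn k), bisectingSet_le_one _,
      sum_bisectingSet (List.forall_mem_ofFn_iff.2 hodd) (List.forall_mem_ofFn_iff.2 hhalf),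
      treeEnergy_bisectingSet hthree⟩
  refine (isLeast_bisectionWidth _).unique ⟨hupper, fun m hm => ?_⟩
  obtain ⟨f, hf, hsum, rfl⟩ := (hsizes m).1 hm
  exact Psi_le_treeEnergy (fun i => Nat.le_of_succ_le (hthree i)) hodd hpair hf hsum
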